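/- Let $G$ be a finite simple graph. Write $N(v)$ and $N[v]=N(v)\cup\{v\}$ for the open and closed neighbourhoods of a vertex $v$, $d(v)$ for its degree, $G[W]$ for the subgraph induced by $W\subseteq V(G)$, $\overline{H}$ for the complement of a graph $H$ (on the vertex set $V(H)$), and $\Delta$ for maximum degree. A $k$-vertex, $k^-$-vertex, $k^+$-vertex is a vertex of degree exactly $k$, at most $k$, at least $k$, respectively. A nonempty set $V_0\subseteq V(G)$ is \emph{reducible} if there are a set $\mathcal S$ of pairwise edge-disjoint triangles of $G$ and a set $X$ of edges of $G$ such that (i) $|X|\le 2|\mathcal S|$; (ii) $G-X$ has no triangle containing a vertex of $V_0$; and (iii) $X$ contains every edge of a triangle in $\mathcal S$ whose endpoints both lie outside $V_0$. The graph $G$ is \emph{robust} if for every vertex $v$ every connected component of $G[N(v)]$ has at least $5$ vertices. A vertex $u$ \emph{subsumes} a vertex $v\neq u$ if $N[v]\subseteq N[u]$ (equivalently, $u$ is a dominating vertex of $G[N(v)]$). A $6$-vertex $v$ is \emph{thin} if $\overline{G[N(v)]}$ contains a matching of size $3$. If $G$ is robust and has no reducible set, then: (a) every $6^-$-vertex $v$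 satisfies $\Delta(\overline{G[N(v)]})\le 1$ and $|E(\overline{G[N(v)]})|\neq 2$; (b) the $6^-$-vertices of $G$ form an independent set; (c) no $7$-vertex subsumes any $6$-vertex; (d) no $7$-vertex is adjacent to any thin $6$-vertex; (e) no $8^-$-vertex subsumes any $5$-vertex; (f) every $9$-vertex subsumes at most three $6^-$-vertices, and a $9$-vertex subsuming three $6^-$-vertices is adjacent to exactly three $6^-$-vertices; (g) every $10^+$-vertex $v$ that subsumes some $6^-$-vertex has at most $d(v)-6$ neighbours that are $6^-$-vertices; (h) every vertex $v$ with $d(v)\in\{7,8,9\}$ has at most $d(v)-4$ neighbours that are $6^-$-vertices. -/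

import Mathlib

namespace SimpleGraph

/-- The set of edges of a triangle `T`, given as a set of three vertices: all unordered pairs of
two distinct vertices of `T`. -/
def triangleEdges {V : Type*} (T : Finset V) : Set (Sym2 V) :=
  {e | ¬ e.IsDiag ∧ ∀ x ∈ e, x ∈ T}

/-- The vertex set `V₀` is reducible in `G` using the set `S` of edge-disjoint triangles of `G` and
the set `X` of edges of `G`. -/
structure IsReducibleUsing {V : Type*} (G : SimpleGraph V) (V₀ : Set V)
    (S : Finset (Finset V)) (X : Finset (Sym2 V)) : Prop where
  nonempty : V₀.Nonempty
  isTriangle : ∀ T ∈ S, G.IsNClique 3 T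
  edgeDisjoint : ∀ T ∈ S, ∀ T' ∈ S, T ≠ T' → Disjoint (triangleEdges T) (triangleEdges T')
  subset_edgeSet : (X : Set (Sym2 V)) ⊆ G.edgeSet
  card_le : X.card ≤ 2 * S.card
  no_triangle : ∀ T : Finset V, (G.deleteEdges (X : Set (Sym2 V))).IsNClique 3 T →
    ∀ v ∈ V₀, v ∉ T
  mem_of_outside : ∀ T ∈ S, ∀ e ∈ triangleEdges T, (∀ x ∈ e, x ∉ V₀) → e ∈ X

/-- The vertex set `V₀` is reducible in `G`. -/
def IsReducible {V : Type*} (G : SimpleGraph V) (V₀ : Set V) : Prop :=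
  ∃ (S : Finset (Finset V)) (X : Finset (Sym2 V)), G.IsReducibleUsing V₀ S X

/-- The subgraph `G[N(v)]` induced by the (open) neighbourhood of `v`. -/
abbrev nbhdGraph {V : Type*} (G : SimpleGraph V) (v : V) : SimpleGraph (G.neighborSet v) :=
  G.induce (G.neighborSet v)

/-- `G` is robust: for every vertex `v`, every component of `G[N(v)]` has at least five
vertices. -/
def IsRobust {V : Type*} (G : SimpleGraph V) : Prop :=
  ∀ v : V, ∀ C : (G.nbhdGraph v).ConnectedComponent, 5 ≤ C.supp.encard

/-- The closed neighbourhood `N[v]`. -/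
def closedNbhd {V : Type*} (G : SimpleGraph V) (v : V) : Set V :=
  insert v (G.neighborSet v)

/-- `u` subsumes the (other) vertex `v`: `N[u] ⊇ N[v]`. Equivalently, `u` is a dominating vertex
of `G[N(v)]`; see `subsumes_iff`. -/
def Subsumes {V : Type*} (G : SimpleGraph V) (u v : V) : Prop :=
  u ≠ v ∧ G.closedNbhd v ⊆ G.closedNbhd u

theorem subsumes_iff {V : Type*} (G : SimpleGraph V) (u v : V) :
    G.Subsumes u v ↔ G.Adj v u ∧ ∀ w, G.Adj v w → w ≠ u → G.Adj u w := by
  simp only [Subsumes, closedNbhd, Set.subset_def, Set.mem_insert_iff, mem_neighborSet]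
  constructor
  · rintro ⟨hne, h⟩
    exact ⟨((h v (Or.inl rfl)).resolve_left (Ne.symm hne)).symm,
      fun w hw hwu => (h w (Or.inr hw)).resolve_left hwu⟩
  · rintro ⟨h1, h2⟩
    refine ⟨h1.ne', fun w hw => ?_⟩
    by_cases hwu : w = u
    · exact Or.inl hwu
    · rcases hw with rfl | hw
      · exact Or.inr h1.symm
      · exact Or.inr (h2 w hw hwu)

/-- `v` is a thin `6`-vertex: `v` has degree `6` and the complement of `G[N(v)]` contains a
matching with three edges. -/
def IsThin {V : Type*} (G : SimpleGraph V) (v : V) [Fintype (G.neighborSet v)] : Prop :=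
  G.degree v = 6 ∧ ∃ M : ((G.nbhdGraph v)ᶜ).Subgraph, M.IsMatching ∧ M.edgeSet.ncard = 3

end SimpleGraph

/-! A set of s edge-disjoint triangles pays for the deletion of 2s edges, so every assertion is
refuted by exhibiting triangles and a cut within this budget. Two mechanisms supply them.

For configurations with at most ten named vertices the argument is a finite case analysis. A
certificate consists of a core, triangles and a cut; it works as soon as certain pairs are edges
(the triangle sides) and certain pairs are nonedges (those closing an uncut triangle with a core
vertex). `CaseData.contradiction` shows that in every completion of the known adjacencies some
certificate works, or a small set of neighbours is cut off in a neighbourhood, against robustness,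
or known bounds on nonedges fail. Since every neighbour of a core vertex is named, nothing outside
the configuration matters. The kernel verifies that the cases are exhausted.

In this way a $6^-$-vertex, which has degree 5 or 6 by robustness, is shown to have a neighbourhood
whose complement is a matching: at most one edge for degree 5; zero, one or three edges for degree
6; at most one edge if the vertex is subsumed. Hence two adjacent $6^-$-vertices have at most one
private neighbour each, leaving five configurations, which the Fano plane minus a line, a four-cycle
joined alternately to two vertices, or similar packings exclude. Such packings also exclude the
subsuming and thin configurations around vertices of degree 7 and 8.

Bounds on the number of $6^-$-neighbours come from Hall's theorem. Low neighbours of v (degree at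
most 6) are independent, and each is adjacent to at least three high neighbours (to four if
subsumed). If there are too many low neighbours, then the high ones can be matched into them, one
exceptional vertex aside. A matching of size k gives k triangles at v, paying for the matching edges
and for k edges from v to high vertices, which meet all other triangles at v: see
`isReducible_of_matching`. The one situation at degree 9 out of reach of this argument, four low and
five high neighbours, is again finite and is split by which high neighbour each subsumed vertex may
miss. -/

namespace SimpleGraph

/-! ### Certificates for reducibility on a numbered part of a graph

Vertices of interest are numbered by a map `f : ℕ → V`; an unordered pair of numbers below `10` is
encoded as a single number. -/

/-- The code of the unordered pair `{i, j}`. -/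
def pairCode (i j : ℕ) : ℕ :=
  bif Nat.blt i j then Nat.add (Nat.div (Nat.mul j (Nat.succ j)) 2) i
  else Nat.add (Nat.div (Nat.mul i (Nat.succ i)) 2) j

/-- The pairs of numbers below `10`, in the order of their codes. -/
def pairTable : List (ℕ × ℕ) :=
  (List.range 10).flatMap fun j => (List.range (j + 1)).map fun i => (i, j)

/-- The smaller number of the pair with code `c`. -/
def codeFst (c : ℕ) : ℕ := (pairTable.getD c (0, 0)).1

/-- The larger number of the pair with code `c`. -/
def codeSnd (c : ℕ) : ℕ := (pairTable.getD c (0, 0)).2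

/-- The pair with code `c` is an edge of `G`. -/
def CodeAdj {V : Type*} (G : SimpleGraph V) (f : ℕ → V) (c : ℕ) : Prop :=
  G.Adj (f (codeFst c)) (f (codeSnd c))

/-- Boolean membership, cheap to evaluate. -/
def memb (c : ℕ) (l : List ℕ) : Bool := l.any (Nat.beq c)

/-- Boolean test for the absence of repetitions. -/
def nodupb : List ℕ → Bool
  | [] => true
  | a :: l => !memb a l && nodupb l

/-- Codes of all pairs of entries of a list. -/
def pairCodes : List ℕ → List ℕ
  | [] => []
  | a :: l => l.map (pairCode a) ++ pairCodes l

/-- All pairs of entries of a list. -/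
def listPairs : List ℕ → List (ℕ × ℕ)
  | [] => []
  | a :: l => l.map (fun b => (a, b)) ++ listPairs l

/-- A condition asking the pairs with codes in the first list to be edges and those with codes in
the second list to be nonedges. -/
abbrev Term := List ℕ × List ℕ

/-- The condition `t` is satisfied by `α`. -/
def Term.Holds (t : Term) (α : ℕ → Prop) : Prop :=
  (∀ c ∈ t.1, α c) ∧ ∀ c ∈ t.2, ¬ α c

@[simp] theorem memb_iff {c : ℕ} {l : List ℕ} : memb c l = true ↔ c ∈ l := by
  simp [memb]

theorem not_natBeq {c d : ℕ} : (!Nat.beq c d) = true ↔ c ≠ d := by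
  rw [Bool.not_eq_true', ← Bool.not_eq_true, Nat.beq_eq]

theorem nodup_of_nodupb : ∀ {l : List ℕ}, nodupb l = true → l.Nodup
  | [], _ => List.nodup_nil
  | a :: l, h => by
    rw [nodupb, Bool.and_eq_true, Bool.not_eq_true', ← Bool.not_eq_true, memb_iff] at h
    exact List.nodup_cons.2 ⟨h.1, nodup_of_nodupb h.2⟩

/-- The code is the triangular number of the larger entry plus the smaller one, so the table lists
the pairs in code order; for ten numbers this is a finite check. -/
theorem pairCode_cases {i j : ℕ} (hi : i < 10) (hj : j < 10) :
    (codeFst (pairCode i j) = i ∧ codeSnd (pairCode i j) = j) ∨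
      (codeFst (pairCode i j) = j ∧ codeSnd (pairCode i j) = i) := by
  have : ∀ i < 10, ∀ j < 10, (codeFst (pairCode i j) = i ∧ codeSnd (pairCode i j) = j) ∨
      (codeFst (pairCode i j) = j ∧ codeSnd (pairCode i j) = i) := by decide +kernel
  exact this i hi j hj

theorem pairCode_comm (i j : ℕ) : pairCode i j = pairCode j i := by
  unfold pairCode
  rcases lt_trichotomy i j with h | rfl | h
  · have h1 : Nat.blt i j = true := by simpa using h
    have h2 : Nat.blt j i = false := Bool.eq_false_iff.2 fun h' => by rw [Nat.blt_eq] at h'; omega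
    simp [h1, h2]
  · rfl
  · have h1 : Nat.blt j i = true := by simpa using h
    have h2 : Nat.blt i j = false := Bool.eq_false_iff.2 fun h' => by rw [Nat.blt_eq] at h'; omega
    simp [h1, h2]

theorem pairCode_codeFst_codeSnd {i j : ℕ} (hi : i < 10) (hj : j < 10) :
    pairCode (codeFst (pairCode i j)) (codeSnd (pairCode i j)) = pairCode i j := by
  rcases pairCode_cases hi hj with ⟨h1, h2⟩ | ⟨h1, h2⟩ <;> rw [h1, h2]
  exact pairCode_comm _ _

theorem mem_listPairs {i j : ℕ} : ∀ {l : List ℕ}, i ∈ l → j ∈ l → i ≠ j →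
    (i, j) ∈ listPairs l ∨ (j, i) ∈ listPairs l
  | a :: l, hi, hj, hij => by
    simp only [listPairs, List.mem_append, List.mem_map, Prod.mk.injEq]
    rcases List.mem_cons.1 hi with rfl | hi' <;> rcases List.mem_cons.1 hj with rfl | hj'
    · exact absurd rfl hij
    · exact Or.inl (Or.inl ⟨j, hj', rfl, rfl⟩)
    · exact Or.inr (Or.inl ⟨i, hi', rfl, rfl⟩)
    · exact (mem_listPairs hi' hj' hij).imp Or.inr Or.inr

theorem exists_of_mem_pairCodes {c : ℕ} : ∀ {l : List ℕ}, l.Nodup → c ∈ pairCodes l →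
    ∃ i ∈ l, ∃ j ∈ l, i ≠ j ∧ c = pairCode i j
  | a :: l, hl, hc => by
    rw [List.nodup_cons] at hl
    rw [pairCodes, List.mem_append, List.mem_map] at hc
    rcases hc with ⟨j, hj, rfl⟩ | hc
    · exact ⟨a, List.mem_cons_self, j, List.mem_cons_of_mem _ hj,
        fun h => hl.1 (h ▸ hj), rfl⟩
    · obtain ⟨i, hi, j, hj, hij, rfl⟩ := exists_of_mem_pairCodes hl.2 hc
      exact ⟨i, List.mem_cons_of_mem _ hi, j, List.mem_cons_of_mem _ hj, hij, rfl⟩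

/-- The set of codes in a list, as a bit mask. -/
def codeMask (l : List ℕ) : ℕ := l.foldr (fun c m => Nat.lor (Nat.pow 2 c) m) 0

theorem testBit_codeMask {c : ℕ} : ∀ {l : List ℕ}, (codeMask l).testBit c = true ↔ c ∈ l
  | [] => by simp [codeMask]
  | d :: l => by
    have ih := testBit_codeMask (c := c) (l := l)
    change (2 ^ d ||| codeMask l).testBit c = true ↔ _
    rw [Nat.testBit_or, Bool.or_eq_true, Nat.testBit_two_pow,
      List.mem_cons]
    rw [ih, decide_eq_true_eq, eq_comm]

/-- Evaluate a function at a number after computing that number. -/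
def withNat {β : Type*} (m : ℕ) (g : ℕ → β) : β :=
  match m with
  | .zero => g .zero
  | .succ k => g (.succ k)

theorem withNat_eq {β : Type*} (m : ℕ) (g : ℕ → β) : withNat m g = g m := by
  cases m <;> rfl

section

variable {V : Type*} {G : SimpleGraph V} {f : ℕ → V}

theorem codeAdj_pairCode {i j : ℕ} (hi : i < 10) (hj : j < 10) :
    CodeAdj G f (pairCode i j) ↔ G.Adj (f i) (f j) := by
  unfold CodeAdj
  rcases pairCode_cases hi hj with ⟨h1, h2⟩ | ⟨h1, h2⟩ <;> rw [h1, h2]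
  exact G.adj_comm _ _

/-- The unordered pair of vertices with code `c`. -/
def codeEdge (f : ℕ → V) (c : ℕ) : Sym2 V := s(f (codeFst c), f (codeSnd c))

theorem codeEdge_pairCode {i j : ℕ} (hi : i < 10) (hj : j < 10) :
    codeEdge f (pairCode i j) = s(f i, f j) := by
  unfold codeEdge
  rcases pairCode_cases hi hj with ⟨h1, h2⟩ | ⟨h1, h2⟩ <;> rw [h1, h2]
  exact Sym2.eq_swap

end

/-- A certificate of reducibility: the numbers of the vertices in `V₀`, the triangles in `S`, and
the codes of the edges in `X`. -/
structure Cert where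
  core : List ℕ
  tris : List (ℕ × ℕ × ℕ)
  cut : List ℕ

/-- Codes of the sides of a triangle. -/
def sides (t : ℕ × ℕ × ℕ) : List ℕ :=
  [pairCode t.1 t.2.1, pairCode t.1 t.2.2, pairCode t.2.1 t.2.2]

/-- The combinatorial conditions on a certificate. The list `hubs` contains pairs of a vertex and a
list containing its neighbours. -/
def Cert.valid (n : ℕ) (hubs : List (ℕ × List ℕ)) (K : Cert) : Bool :=
  !K.core.isEmpty && K.core.all (fun i => memb i (hubs.map Prod.fst)) &&
  K.tris.all (fun t => Nat.blt t.1 n && Nat.blt t.2.1 n && Nat.blt t.2.2 n &&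
    nodupb [t.1, t.2.1, t.2.2]) &&
  nodupb (K.tris.flatMap sides) &&
  Nat.ble K.cut.length (Nat.mul 2 K.tris.length) &&
  K.tris.all (fun t => (listPairs [t.1, t.2.1, t.2.2]).all fun p =>
    memb p.1 K.core || memb p.2 K.core || memb (pairCode p.1 p.2) K.cut)

/-- The masks of the sides not at `p.1`, and of all sides, of the triangles formed by `p.1` and two
entries of `p.2`. -/
def hubMasks (p : ℕ × List ℕ) : List (ℕ × ℕ) :=
  (listPairs p.2).foldl (fun acc q => withNat (Nat.pow 2 (pairCode q.1 q.2)) fun a =>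
    withNat (Nat.lor a (Nat.lor (Nat.pow 2 (pairCode p.1 q.1)) (Nat.pow 2 (pairCode p.1 q.2))))
      fun b => (a, b) :: acc) []

/-- Add to `acc` the first components in a list whose second component is disjoint from `m`. -/
def addUncovered (m : ℕ) : List (ℕ × ℕ) → ℕ → ℕ
  | [], acc => acc
  | t :: L, acc => bif Nat.beq (Nat.land m t.2) 0 then
      withNat (Nat.lor acc t.1) fun a => addUncovered m L a else addUncovered m L acc

/-- The mask of the pairs that form a triangle with a vertex in `core` that contains no pair in the
mask `m`. -/
def uncovered (core : List ℕ) (m : ℕ) : List (ℕ × List ℕ) → ℕ → ℕ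
  | [], acc => acc
  | p :: hubs, acc => bif memb p.1 core then
      withNat (addUncovered m (hubMasks p) acc) fun a => uncovered core m hubs a
      else uncovered core m hubs acc

/-- The condition under which a certificate proves reducibility, as masks of the pairs that have to
be edges and nonedges. -/
def Cert.masks (hubs : List (ℕ × List ℕ)) (K : Cert) : ℕ × ℕ :=
  (codeMask (K.tris.flatMap sides), withNat (codeMask K.cut) fun m => uncovered K.core m hubs 0)

theorem mem_hubMasks {p : ℕ × List ℕ} {i j : ℕ} (hi : i ∈ p.2) (hj : j ∈ p.2) (hij : i ≠ j) :
    ∃ m, (2 ^ pairCode i j, m) ∈ hubMasks p ∧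
      ∀ d, m.testBit d = true → d = pairCode i j ∨ d = pairCode p.1 i ∨ d = pairCode p.1 j := by
  have key : ∀ (l : List (ℕ × ℕ)) (acc : List (ℕ × ℕ)), l.foldl (fun acc q =>
      withNat (Nat.pow 2 (pairCode q.1 q.2)) fun a =>
        withNat (Nat.lor a (Nat.lor (Nat.pow 2 (pairCode p.1 q.1)) (Nat.pow 2 (pairCode p.1 q.2))))
          fun b => (a, b) :: acc) acc =
      (l.map fun q => (2 ^ pairCode q.1 q.2, 2 ^ pairCode q.1 q.2 ||| (2 ^ pairCode p.1 q.1 |||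
        2 ^ pairCode p.1 q.2))).reverse ++ acc := by
    intro l
    induction l with
    | nil => intro acc; rfl
    | cons d l ih =>
      intro acc
      rw [List.foldl_cons, ih, withNat_eq, withNat_eq, List.map_cons, List.reverse_cons,
        List.append_assoc]
      rfl
  rw [hubMasks, key, List.append_nil]
  simp only [List.mem_reverse, List.mem_map]
  rcases mem_listPairs hi hj hij with h | h
  · refine ⟨_, ⟨_, h, rfl⟩, fun d hd => ?_⟩
    simp only [Nat.testBit_or, Nat.testBit_two_pow, Bool.or_eq_true, decide_eq_true_eq] at hd
    tauto
  · refine ⟨_, ⟨_, h, by rw [pairCode_comm]⟩, fun d hd => ?_⟩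
    simp only [Nat.testBit_or, Nat.testBit_two_pow, Bool.or_eq_true, decide_eq_true_eq] at hd
    tauto

theorem testBit_addUncovered {m d : ℕ} : ∀ {L : List (ℕ × ℕ)} {acc : ℕ},
    acc.testBit d = true ∨ (∃ t ∈ L, m &&& t.2 = 0 ∧ t.1.testBit d = true) →
      (addUncovered m L acc).testBit d = true
  | [], acc, h => by simpa [addUncovered] using h
  | t :: L, acc, h => by
    rw [addUncovered, withNat_eq]
    cases hb : Nat.beq (Nat.land m t.2) 0
    · refine testBit_addUncovered (h.imp_right ?_)
      rintro ⟨s, hs, hsm, hsd⟩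
      rcases List.mem_cons.1 hs with rfl | hs
      · rw [show Nat.land m s.2 = 0 from hsm] at hb
        exact absurd hb (by simp)
      · exact ⟨s, hs, hsm, hsd⟩
    · have hor : (Nat.lor acc t.1).testBit d = (acc.testBit d || t.1.testBit d) :=
        Nat.testBit_or _ _ _
      rw [cond_true]
      apply testBit_addUncovered
      rw [hor, Bool.or_eq_true]
      rcases h with h | ⟨s, hs, h⟩
      · exact Or.inl (Or.inl h)
      · rcases List.mem_cons.1 hs with rfl | hs
        · exact Or.inl (Or.inr h.2)
        · exact Or.inr ⟨s, hs, h⟩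

/-- Soundness needs only this inclusion: every pair that could close an uncut triangle at a core
vertex is in the mask, hence required to be a nonedge. Superfluous bits would merely strengthen the
requirement. -/
theorem testBit_uncovered {core l : List ℕ} {i j : ℕ} (hij : i ≠ j) :
    ∀ {hubs : List (ℕ × List ℕ)} {acc : ℕ}, acc.testBit (pairCode i j) = true ∨
      (∃ p ∈ hubs, p.1 ∈ core ∧ i ∈ p.2 ∧ j ∈ p.2 ∧ pairCode i j ∉ l ∧
        pairCode p.1 i ∉ l ∧ pairCode p.1 j ∉ l) →
      (uncovered core (codeMask l) hubs acc).testBit (pairCode i j) = true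
  | [], acc, h => by simpa [uncovered] using h
  | p :: hubs, acc, h => by
    rw [uncovered, withNat_eq]
    cases hb : memb p.1 core
    · refine testBit_uncovered hij (h.imp_right ?_)
      rintro ⟨q, hq, hqc, hqd⟩
      rcases List.mem_cons.1 hq with rfl | hq
      · exact absurd (memb_iff.2 hqc) (by simp [hb])
      · exact ⟨q, hq, hqc, hqd⟩
    · rw [cond_true]
      apply testBit_uncovered hij
      rcases h with h | ⟨q, hq, h⟩
      · exact Or.inl (testBit_addUncovered (Or.inl h))
      · rcases List.mem_cons.1 hq with rfl | hq
        · obtain ⟨m, hm, hmd⟩ := mem_hubMasks h.2.1 h.2.2.1 hij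
          refine Or.inl (testBit_addUncovered (Or.inr ⟨_, hm, ?_, by simp⟩))
          refine Nat.eq_of_testBit_eq fun e => ?_
          rw [Nat.zero_testBit, ← Bool.not_eq_true, Nat.testBit_and, Bool.and_eq_true,
            testBit_codeMask]
          rintro ⟨he, hme⟩
          rcases hmd e hme with rfl | rfl | rfl
          · exact h.2.2.2.1 he
          · exact h.2.2.2.2.1 he
          · exact h.2.2.2.2.2 he
        · exact Or.inr ⟨q, hq, h⟩

/-- The masks `t` describe a condition satisfied by `α`. -/
def MaskHolds (t : ℕ × ℕ) (α : ℕ → Prop) : Prop :=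
  (∀ c, t.1.testBit c = true → α c) ∧ ∀ c, t.2.testBit c = true → ¬ α c

/-! ### Soundness of certificates -/

section

variable {V : Type*} {G : SimpleGraph V} {f : ℕ → V} {n : ℕ} {hubs : List (ℕ × List ℕ)}

/-- The vertices of a triangle given by numbers. -/
def triVerts [DecidableEq V] (f : ℕ → V) (t : ℕ × ℕ × ℕ) : Finset V := {f t.1, f t.2.1, f t.2.2}

theorem exists_code_of_mem_triangleEdges [DecidableEq V] {t : ℕ × ℕ × ℕ}
    (ht : t.1 < 10 ∧ t.2.1 < 10 ∧ t.2.2 < 10) {e : Sym2 V}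
    (he : e ∈ triangleEdges (triVerts f t)) : ∃ c ∈ sides t, e = codeEdge f c := by
  obtain ⟨hd, hm⟩ := he
  obtain ⟨a, b, c⟩ := t
  simp only at ht
  have h1 := codeEdge_pairCode (f := f) ht.1 ht.2.1
  have h2 := codeEdge_pairCode (f := f) ht.1 ht.2.2
  have h3 := codeEdge_pairCode (f := f) ht.2.1 ht.2.2
  simp only [sides, List.mem_cons, List.not_mem_nil, or_false, exists_eq_or_imp,
    exists_eq_left, h1, h2, h3]
  induction e with
  | _ x y =>
    simp only [triVerts, Sym2.mem_iff, Finset.mem_insert, Finset.mem_singleton, forall_eq_or_imp,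
      forall_eq, Sym2.mk_isDiag_iff] at hm hd
    obtain ⟨rfl | rfl | rfl, rfl | rfl | rfl⟩ := hm <;> simp at hd ⊢

/-- A valid certificate whose condition holds gives a reducible set. -/
theorem Cert.isReducible (hn : n ≤ 10) (inj : Set.InjOn f {i | i < n})
    (hlt : ∀ p ∈ hubs, p.1 < n ∧ ∀ i ∈ p.2, i < n)
    (hhub : ∀ p ∈ hubs, ∀ x, G.Adj (f p.1) x → x ∈ p.2.map f) {K : Cert}
    (hK : K.valid n hubs = true) (ht : MaskHolds (K.masks hubs) (CodeAdj G f)) :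
    ∃ V₀ : Set V, G.IsReducible V₀ := by
  classical
  simp only [Cert.valid, Bool.and_eq_true, Bool.not_eq_true', List.all_eq_true, memb_iff,
    Bool.or_eq_true, Nat.ble_eq, Nat.blt_eq] at hK
  obtain ⟨⟨⟨⟨⟨h0, hcore⟩, htri⟩, hnd⟩, hlen⟩, hout⟩ := hK
  have hnd := nodup_of_nodupb hnd
  obtain ⟨hP, hF⟩ := ht
  have lt10 : ∀ t ∈ K.tris, t.1 < 10 ∧ t.2.1 < 10 ∧ t.2.2 < 10 := fun t h => by
    have := htri t h
    omega
  have hdist : ∀ t ∈ K.tris, f t.1 ≠ f t.2.1 ∧ f t.1 ≠ f t.2.2 ∧ f t.2.1 ≠ f t.2.2 := by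
    intro t h
    obtain ⟨⟨⟨h1, h2⟩, h3⟩, h4⟩ := htri t h
    have h4 := nodup_of_nodupb h4
    simp only [List.nodup_cons, List.mem_cons, List.not_mem_nil, or_false, not_or,
      not_false_eq_true, and_true, List.nodup_nil] at h4
    exact ⟨fun h => h4.1.1 (inj h1 h2 h), fun h => h4.1.2 (inj h1 h3 h),
      fun h => h4.2 (inj h2 h3 h)⟩
  have hsideP : ∀ t ∈ K.tris, ∀ c ∈ sides t, CodeAdj G f c := fun t h c hc =>
    hP c (testBit_codeMask.2 (List.mem_flatMap.2 ⟨t, h, hc⟩))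
  have hsidelt : ∀ t ∈ K.tris, ∀ c ∈ sides t, codeFst c < n ∧ codeSnd c < n ∧
      pairCode (codeFst c) (codeSnd c) = c := by
    intro t h c hc
    obtain ⟨h1, h2, h3⟩ := lt10 t h
    have := htri t h
    simp only [sides, List.mem_cons, List.not_mem_nil, or_false] at hc
    rcases hc with rfl | rfl | rfl
    · have := pairCode_cases h1 h2; have := pairCode_codeFst_codeSnd h1 h2; omega
    · have := pairCode_cases h1 h3; have := pairCode_codeFst_codeSnd h1 h3; omega
    · have := pairCode_cases h2 h3; have := pairCode_codeFst_codeSnd h2 h3; omega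
  -- A common edge would give a common side code, as `f` is injective below `n`, while the side
  -- codes of all triangles are without repetition.
  have hinj : ∀ t ∈ K.tris, ∀ t' ∈ K.tris, ∀ e, e ∈ triangleEdges (triVerts f t) →
      e ∈ triangleEdges (triVerts f t') → t = t' := by
    intro t h t' h' e he he'
    obtain ⟨c, hc, rfl⟩ := exists_code_of_mem_triangleEdges (lt10 t h) he
    obtain ⟨c', hc', hcc⟩ := exists_code_of_mem_triangleEdges (lt10 t' h') he'
    have hceq : c = c' := by
      have l1 := hsidelt t h c hc
      have l2 := hsidelt t' h' c' hc'
      rw [← l1.2.2, ← l2.2.2]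
      rcases Sym2.eq_iff.1 hcc with ⟨e1, e2⟩ | ⟨e1, e2⟩
      · rw [inj l1.1 l2.1 e1, inj l1.2.1 l2.2.1 e2]
      · rw [inj l1.1 l2.2.1 e1, inj l1.2.1 l2.1 e2, pairCode_comm]
    subst hceq
    have hpw := (List.nodup_flatMap.1 hnd).2
    by_contra hne
    have hpw' : K.tris.Pairwise fun a b => c ∈ sides a → c ∈ sides b → a = b :=
      hpw.imp fun hd ha hb => absurd hb (hd ha)
    have : Std.Symm fun a b => c ∈ sides a → c ∈ sides b → a = b :=
      ⟨fun _ _ h a b => (h b a).symm⟩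
    exact hne (hpw'.forall_of_forall (fun _ _ _ _ => rfl) h h' hc hc')
  have hmemE : ∀ t ∈ K.tris, s(f t.1, f t.2.1) ∈ triangleEdges (triVerts f t) := by
    intro t h
    refine ⟨by simpa using (hdist t h).1, ?_⟩
    intro x hx
    rcases Sym2.mem_iff.1 hx with rfl | rfl <;> simp [triVerts]
  have hSinj : ∀ t ∈ K.tris, ∀ t' ∈ K.tris, triVerts f t = triVerts f t' → t = t' :=
    fun t h t' h' heq => hinj t h t' h' _ (hmemE t h) (heq ▸ hmemE t h)
  have hnodup : K.tris.Nodup := by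
    refine List.Pairwise.imp ?_ (List.nodup_flatMap.1 hnd).2
    rintro a b hd rfl
    exact hd (List.mem_cons_self (l := [pairCode a.1 a.2.2, pairCode a.2.1 a.2.2])) List.mem_cons_self
  -- Cut pairs that are not edges are dropped, so a certificate may list pairs whose adjacency is
  -- unknown.
  set X := (K.cut.map (codeEdge f)).toFinset.filter (· ∈ G.edgeSet) with hX
  refine ⟨{x | ∃ i ∈ K.core, f i = x}, (K.tris.map (triVerts f)).toFinset, X, ?_⟩
  have hXmem : ∀ i j, i < 10 → j < 10 → G.Adj (f i) (f j) → pairCode i j ∈ K.cut →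
      s(f i, f j) ∈ X := by
    intro i j hi hj ha hc
    rw [hX, Finset.mem_filter, List.mem_toFinset, List.mem_map]
    exact ⟨⟨_, hc, codeEdge_pairCode hi hj⟩, ha⟩
  constructor
  · obtain ⟨i, hi⟩ := List.exists_mem_of_ne_nil K.core (by simpa using h0)
    exact ⟨f i, i, hi, rfl⟩
  · intro T hT
    obtain ⟨t, h, rfl⟩ := List.mem_map.1 (List.mem_toFinset.1 hT)
    obtain ⟨h1, h2, h3⟩ := lt10 t h
    rw [triVerts, is3Clique_triple_iff]
    refine ⟨(codeAdj_pairCode h1 h2).1 (hsideP t h _ ?_),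
      (codeAdj_pairCode h1 h3).1 (hsideP t h _ ?_),
      (codeAdj_pairCode h2 h3).1 (hsideP t h _ ?_)⟩ <;> simp [sides]
  · intro T hT T' hT' hne
    obtain ⟨t, h, rfl⟩ := List.mem_map.1 (List.mem_toFinset.1 hT)
    obtain ⟨t', h', rfl⟩ := List.mem_map.1 (List.mem_toFinset.1 hT')
    rw [Set.disjoint_left]
    intro e he he'
    exact hne (by rw [hinj t h t' h' e he he'])
  · intro e he
    exact (Finset.mem_filter.1 he).2
  · have h1 : (K.tris.map (triVerts f)).toFinset.card = K.tris.length := by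
      rw [List.toFinset_card_of_nodup, List.length_map]
      exact List.Nodup.map_on (fun t h t' h' => hSinj t h t' h') hnodup
    rw [h1]
    refine (Finset.card_filter_le _ _).trans ((List.toFinset_card_le _).trans ?_)
    rwa [List.length_map]
  -- A surviving triangle at a core vertex has its other two vertices in the hub list and avoids the
  -- cut, so its opposite side is one of the required nonedges.
  · rintro T hT v ⟨i, hi, rfl⟩ hv
    obtain ⟨p, hp, rfl⟩ := List.mem_map.1 (hcore i hi)
    have hx : ∃ x y, x ≠ y ∧
        (G.deleteEdges (X : Set (Sym2 V))).Adj (f p.1) x ∧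
        (G.deleteEdges (X : Set (Sym2 V))).Adj (f p.1) y ∧
        (G.deleteEdges (X : Set (Sym2 V))).Adj x y := by
      obtain ⟨a, b, c, hab, hac, hbc, rfl⟩ := is3Clique_iff.1 hT
      simp only [Finset.mem_insert, Finset.mem_singleton] at hv
      rcases hv with h | h | h <;> rw [h]
      · exact ⟨b, c, hbc.ne, hab, hac, hbc⟩
      · exact ⟨a, c, hac.ne, hab.symm, hbc, hac⟩
      · exact ⟨a, b, hab.ne, hac.symm, hbc.symm, hab⟩
    obtain ⟨x, y, hxy, hvx, hvy, hxy'⟩ := hx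
    rw [deleteEdges_adj] at hvx hvy hxy'
    obtain ⟨i, hi', rfl⟩ := List.mem_map.1 (hhub p hp x hvx.1)
    obtain ⟨j, hj', rfl⟩ := List.mem_map.1 (hhub p hp y hvy.1)
    have hij : i ≠ j := fun h => hxy (by rw [h])
    have l0 := (hlt p hp).1
    have l1 := (hlt p hp).2 i hi'
    have l2 := (hlt p hp).2 j hj'
    have n0 : pairCode p.1 i ∉ K.cut := fun h =>
      hvx.2 (hXmem _ _ (by omega) (by omega) hvx.1 h)
    have n1 : pairCode p.1 j ∉ K.cut := fun h =>
      hvy.2 (hXmem _ _ (by omega) (by omega) hvy.1 h)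
    have n2 : pairCode i j ∉ K.cut := fun h =>
      hxy'.2 (hXmem _ _ (by omega) (by omega) hxy'.1 h)
    refine hF (pairCode i j) ?_ ((codeAdj_pairCode (by omega) (by omega)).2 hxy'.1)
    rw [Cert.masks, withNat_eq]
    exact testBit_uncovered hij (Or.inr ⟨p, hp, hi, hi', hj', n2, n0, n1⟩)
  · intro T hT e he hne
    obtain ⟨t, h, rfl⟩ := List.mem_map.1 (List.mem_toFinset.1 hT)
    obtain ⟨c, hc, rfl⟩ := exists_code_of_mem_triangleEdges (lt10 t h) he
    rw [Finset.mem_filter, List.mem_toFinset, List.mem_map]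
    refine ⟨⟨c, ?_, rfl⟩, hsideP t h c hc⟩
    obtain ⟨h1, h2, h3⟩ := lt10 t h
    have key : ∀ i j, i < 10 → j < 10 → (i, j) ∈ listPairs [t.1, t.2.1, t.2.2] →
        c = pairCode i j → c ∈ K.cut := by
      rintro i j hi hj hij rfl
      rw [codeEdge_pairCode hi hj] at hne
      rcases hout t h _ hij with (h1 | h1) | h1
      · exact absurd ⟨_, h1, rfl⟩ (hne _ (Sym2.mem_mk_left _ _))
      · exact absurd ⟨_, h1, rfl⟩ (hne _ (Sym2.mem_mk_right _ _))
      · exact h1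
    simp only [sides, List.mem_cons, List.not_mem_nil, or_false] at hc
    rcases hc with hc | hc | hc
    · exact key _ _ h1 h2 (by simp [listPairs]) hc
    · exact key _ _ h1 h3 (by simp [listPairs]) hc
    · exact key _ _ h2 h3 (by simp [listPairs]) hc

end

end SimpleGraph

namespace SimpleGraph

/-! ### Covering all cases by conditions -/

/-- The conditions in `L`, given by bit masks, that are compatible with the pairs in the mask `pos`
being edges and those in `neg` being nonedges, followed by those in `acc`. -/
def compatible (pos neg : ℕ) : List (ℕ × ℕ) → List (ℕ × ℕ) → List (ℕ × ℕ)
  | [], acc => acc.reverse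
  | t :: L, acc => bif Nat.beq (Nat.land t.1 neg) 0 && Nat.beq (Nat.land t.2 pos) 0 then
      compatible pos neg L (t :: acc) else compatible pos neg L acc

/-- The position of the lowest bit of `m`. -/
def lowBit (m : ℕ) : ℕ := Nat.log2 (Nat.sub m (Nat.land m (Nat.pred m)))

/-- Boolean test showing that one of the conditions in a list, given by bit masks, holds whenever
the pairs in the mask `pos` are edges and those in `neg` are nonedges. -/
def covers : ℕ → ℕ → ℕ → List (ℕ × ℕ) → Bool
  | 0, _, _, _ => false
  | k + 1, pos, neg, L =>
    L.any (fun t => Nat.beq (Nat.land t.1 pos) t.1 && Nat.beq (Nat.land t.2 neg) t.2) ||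
    match compatible pos neg L [] with
    | [] => false
    | t :: L =>
      withNat (lowBit (bif Nat.beq (Nat.land t.1 pos) t.1 then Nat.sub t.2 (Nat.land t.2 neg)
        else Nat.sub t.1 (Nat.land t.1 pos))) fun c =>
      withNat (Nat.lor pos (Nat.pow 2 c)) (fun m => covers k m neg (t :: L)) &&
        withNat (Nat.lor neg (Nat.pow 2 c)) fun m => covers k pos m (t :: L)

/-- The list with all components computed, in reverse order, followed by `acc`. -/
def computeMasks : List (ℕ × ℕ) → List (ℕ × ℕ) → List (ℕ × ℕ)
  | [], acc => acc
  | t :: L, acc => withNat t.1 fun a => withNat t.2 fun b => computeMasks L ((a, b) :: acc)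

theorem computeMasks_eq : ∀ L acc : List (ℕ × ℕ), computeMasks L acc = L.reverse ++ acc
  | [], acc => rfl
  | t :: L, acc => by
    rw [computeMasks, withNat_eq, withNat_eq, computeMasks_eq L]
    simp

theorem mem_of_mem_compatible {pos neg : ℕ} {s : ℕ × ℕ} : ∀ {L acc : List (ℕ × ℕ)},
    s ∈ compatible pos neg L acc → s ∈ L ∨ s ∈ acc
  | [], acc, h => Or.inr (List.mem_reverse.1 h)
  | t :: L, acc, h => by
    rw [compatible] at h
    cases hb : Nat.beq (Nat.land t.1 neg) 0 && Nat.beq (Nat.land t.2 pos) 0 <;>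
      rw [hb] at h <;> rcases mem_of_mem_compatible h with h | h
    · exact Or.inl (List.mem_cons_of_mem _ h)
    · exact Or.inr h
    · exact Or.inl (List.mem_cons_of_mem _ h)
    · rcases List.mem_cons.1 h with rfl | h
      · exact Or.inl List.mem_cons_self
      · exact Or.inr h

theorem testBit_of_land_eq {a b c : ℕ} (h : a &&& b = a) (hc : a.testBit c = true) :
    b.testBit c = true := by
  rw [← h, Nat.testBit_and, Bool.and_eq_true] at hc
  exact hc.2

/-- The check is a decision tree whose nodes ask whether a pair satisfies `α`; following the true
answers leads to a leaf where some condition is already implied. The number `k` only bounds the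
depth. -/
theorem exists_holds_of_covers (α : ℕ → Prop) : ∀ (k pos neg : ℕ) (L : List (ℕ × ℕ)),
    covers k pos neg L = true → (∀ c, pos.testBit c = true → α c) →
    (∀ c, neg.testBit c = true → ¬ α c) →
    ∃ t ∈ L, MaskHolds t α
  | k + 1, pos, neg, L, h, hpos, hneg => by
    have key : ∀ (m c : ℕ) (P : ℕ → Prop), (∀ d, m.testBit d = true → P d) → P c →
        ∀ d, (Nat.lor m (Nat.pow 2 c)).testBit d = true → P d := by
      intro m c P hm hP d hd
      change (m ||| 2 ^ c).testBit d = true at hd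
      rw [Nat.testBit_or, Bool.or_eq_true, Nat.testBit_two_pow, decide_eq_true_eq] at hd
      rcases hd with hd | rfl
      · exact hm d hd
      · exact hP
    unfold covers at h
    rw [Bool.or_eq_true] at h
    rcases h with h | h
    · obtain ⟨t, ht, h⟩ := List.any_eq_true.1 h
      rw [Bool.and_eq_true, Nat.beq_eq, Nat.beq_eq] at h
      exact ⟨t, ht, fun c hc => hpos c (testBit_of_land_eq h.1 hc),
        fun c hc => hneg c (testBit_of_land_eq h.2 hc)⟩
    · split at h
      · exact absurd h (by simp)
      · rename_i t L' hL
        have hsub : ∀ s ∈ t :: L', s ∈ L := fun s hs =>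
          (mem_of_mem_compatible (hL ▸ hs)).resolve_right (by simp)
        rw [withNat_eq, withNat_eq, withNat_eq, Bool.and_eq_true] at h
        -- Any pair may be branched on; its choice only affects the size of the tree.
        generalize lowBit _ = c at h
        have : ∃ s ∈ t :: L', MaskHolds s α := by
          by_cases hα : α c
          · exact exists_holds_of_covers α k _ _ _ h.1 (key _ _ _ hpos hα) hneg
          · exact exists_holds_of_covers α k _ _ _ h.2 hpos (key _ _ (fun c => ¬ α c) hneg hα)
        obtain ⟨s, hs, h⟩ := this
        exact ⟨s, hsub s hs, h⟩

/-- The condition that no edge leads from the set `D` of neighbours of a vertex to its other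
neighbours. -/
def cutTerm (p : ℕ × List ℕ) (D : List ℕ) : Term :=
  (D.map (pairCode p.1), D.flatMap fun d => (p.2.filter fun j => !memb j D).map (pairCode d))

/-- The conditions that two distinct pairs from `A` are nonedges. -/
def twoMissing (A : List ℕ) : List Term :=
  (pairCodes A).flatMap fun c =>
    ((pairCodes A).filter fun d => !Nat.beq c d).map fun d => ([], [c, d])

/-- The conditions that two distinct pairs from `A` with a common entry are nonedges. -/
def pathMissing (A : List ℕ) : List Term :=
  A.flatMap fun i => A.flatMap fun j => A.flatMap fun k =>
    bif nodupb [i, j, k] then [([], [pairCode i j, pairCode i k])] else []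

/-- The pairs of vertices in a list of stars `(i, J)`. -/
def starCodes (l : List (ℕ × List ℕ)) : List ℕ :=
  l.flatMap fun p => p.2.map (pairCode p.1)

/-! ### Conditions excluded by few nonedges or by robustness -/

variable {V : Type*} {G : SimpleGraph V} {f : ℕ → V} {n : ℕ}

/-- The complement of `G` has at most one edge on the entries of a list. -/
def AtMostOneMissing (G : SimpleGraph V) (l : List V) : Prop :=
  ∀ x ∈ l, ∀ y ∈ l, ∀ z ∈ l, ∀ w ∈ l, x ≠ y → z ≠ w → ¬ G.Adj x y → ¬ G.Adj z w →
    s(x, y) = s(z, w)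

/-- The complement of `G` has maximum degree at most one on the entries of a list. -/
def MissingMatching (G : SimpleGraph V) (l : List V) : Prop :=
  ∀ x ∈ l, ∀ y ∈ l, ∀ z ∈ l, x ≠ y → x ≠ z → y ≠ z → G.Adj x y ∨ G.Adj x z

theorem not_holds_of_mem_twoMissing (hn : n ≤ 10) (inj : Set.InjOn f {i | i < n}) {A : List ℕ}
    (hA : A.Nodup) (hlt : ∀ i ∈ A, i < n) (h : AtMostOneMissing G (A.map f)) {t : Term}
    (ht : t ∈ twoMissing A) : ¬ t.Holds (CodeAdj G f) := by
  rintro ⟨-, hF⟩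
  obtain ⟨c, hc, ht⟩ := List.mem_flatMap.1 ht
  obtain ⟨d, hd, rfl⟩ := List.mem_map.1 ht
  obtain ⟨hd', hcd⟩ := List.mem_filter.1 hd
  obtain ⟨i, hi, j, hj, hij, rfl⟩ := exists_of_mem_pairCodes hA hc
  obtain ⟨k, hk, l, hl, hkl, rfl⟩ := exists_of_mem_pairCodes hA hd'
  have li := hlt i hi
  have lj := hlt j hj
  have lk := hlt k hk
  have ll := hlt l hl
  have h1 := hF (pairCode i j) (by simp)
  have h2 := hF (pairCode k l) (by simp)
  rw [codeAdj_pairCode (by omega) (by omega)] at h1 h2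
  have := h _ (List.mem_map_of_mem hi) _ (List.mem_map_of_mem hj) _ (List.mem_map_of_mem hk) _
    (List.mem_map_of_mem hl) (fun h => hij (inj li lj h)) (fun h => hkl (inj lk ll h)) h1 h2
  have hcd : pairCode i j ≠ pairCode k l := not_natBeq.1 hcd
  rcases Sym2.eq_iff.1 this with ⟨e1, e2⟩ | ⟨e1, e2⟩
  · exact hcd (by rw [inj li lk e1, inj lj ll e2])
  · exact hcd (by rw [inj li ll e1, inj lj lk e2, pairCode_comm])

theorem not_holds_of_mem_pathMissing (hn : n ≤ 10) (inj : Set.InjOn f {i | i < n}) {A : List ℕ}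
    (hlt : ∀ i ∈ A, i < n) (h : MissingMatching G (A.map f)) {t : Term}
    (ht : t ∈ pathMissing A) : ¬ t.Holds (CodeAdj G f) := by
  rintro ⟨-, hF⟩
  simp only [pathMissing, List.mem_flatMap] at ht
  obtain ⟨i, hi, j, hj, k, hk, ht⟩ := ht
  have li := hlt i hi
  have lj := hlt j hj
  have lk := hlt k hk
  cases hb : nodupb [i, j, k]
  · rw [hb, cond_false] at ht
    exact absurd ht (by simp)
  · rw [hb, cond_true, List.mem_singleton] at ht
    subst ht
    have hnd := nodup_of_nodupb hb
    simp only [List.nodup_cons, List.mem_cons, List.not_mem_nil, or_false, not_or,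
      not_false_eq_true, and_true, List.nodup_nil] at hnd
    have h1 := hF (pairCode i j) (by simp)
    have h2 := hF (pairCode i k) (by simp)
    rw [codeAdj_pairCode (by omega) (by omega)] at h1 h2
    rcases h _ (List.mem_map_of_mem hi) _ (List.mem_map_of_mem hj) _ (List.mem_map_of_mem hk)
      (fun h => hnd.1.1 (inj li lj h)) (fun h => hnd.1.2 (inj li lk h))
      (fun h => hnd.2 (inj lj lk h)) with h | h
    · exact h1 h
    · exact h2 h

/-- In a robust graph, few neighbours of a vertex have a further common neighbour with it. -/
theorem IsRobust.exists_adj (h : G.IsRobust) {v : V} {D : Finset V} (hD : ∀ d ∈ D, G.Adj v d)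
    (hne : D.Nonempty) (hcard : D.card ≤ 4) : ∃ d ∈ D, ∃ x ∉ D, G.Adj v x ∧ G.Adj d x := by
  classical
  by_contra! hcon
  obtain ⟨d, hd⟩ := hne
  -- If no edge of the neighbourhood leaves `D`, then no walk does, so the component of `d` has at
  -- most four vertices.
  have key : ∀ y : G.neighborSet v, (G.nbhdGraph v).Reachable ⟨d, hD d hd⟩ y → (y : V) ∈ D := by
    rintro y ⟨p⟩
    have : ∀ (a b : G.neighborSet v) (p : (G.nbhdGraph v).Walk a b), (a : V) ∈ D → (b : V) ∈ D := by
      intro a b p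
      induction p with
      | nil => exact id
      | @cons a b c hab p ih =>
        intro ha
        refine ih ?_
        by_contra hb
        exact hcon a ha b hb b.2 hab
    exact this _ _ p hd
  have h5 := h v ((G.nbhdGraph v).connectedComponentMk ⟨d, hD d hd⟩)
  have hsub : (Subtype.val '' ((G.nbhdGraph v).connectedComponentMk ⟨d, hD d hd⟩).supp) ⊆
      (D : Set V) := by
    rintro _ ⟨y, hy, rfl⟩
    exact key y (ConnectedComponent.exact (ConnectedComponent.mem_supp_iff _ _ |>.1 hy)).symm
  have h4 := Set.encard_le_encard hsub
  rw [Subtype.val_injective.injOn.encard_image, Set.encard_coe_eq_coe_finsetCard] at h4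
  have h6 : (5 : ℕ∞) ≤ 4 := h5.trans (h4.trans (by exact_mod_cast hcard))
  exact absurd h6 (by decide)

/-- Otherwise `D` would be a union of components of the neighbourhood of the hub, with at most four
vertices in all. -/
theorem not_holds_cutTerm (hn : n ≤ 10) (hrob : G.IsRobust)
    {p : ℕ × List ℕ} (hlt : p.1 < n ∧ ∀ i ∈ p.2, i < n)
    (hhub : ∀ x, G.Adj (f p.1) x → x ∈ p.2.map f) {D : List ℕ} (hD : ∀ d ∈ D, d < n)
    (hne : D ≠ []) (hlen : D.length ≤ 4) : ¬ (cutTerm p D).Holds (CodeAdj G f) := by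
  classical
  rintro ⟨hP, hF⟩
  have l0 := hlt.1
  obtain ⟨d, hd, x, hx, hvx, hdx⟩ := hrob.exists_adj (v := f p.1) (D := (D.map f).toFinset)
    (by
      intro d hd
      obtain ⟨i, hi, rfl⟩ := List.mem_map.1 (List.mem_toFinset.1 hd)
      have := hD i hi
      exact (codeAdj_pairCode (by omega) (by omega)).1
        (hP (pairCode p.1 i) (List.mem_map_of_mem hi)))
    (by
      obtain ⟨i, hi⟩ := List.exists_mem_of_ne_nil D hne
      exact ⟨f i, List.mem_toFinset.2 (List.mem_map_of_mem hi)⟩)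
    ((List.toFinset_card_le _).trans (by rwa [List.length_map]))
  obtain ⟨i, hi, rfl⟩ := List.mem_map.1 (List.mem_toFinset.1 hd)
  obtain ⟨j, hj, rfl⟩ := List.mem_map.1 (hhub x hvx)
  have := hD i hi
  have := hlt.2 j hj
  have hjD : j ∉ D := fun h => hx (List.mem_toFinset.2 (List.mem_map_of_mem h))
  refine hF (pairCode i j) (List.mem_flatMap.2 ⟨i, hi, List.mem_map_of_mem
    (List.mem_filter.2 ⟨hj, ?_⟩)⟩) ((codeAdj_pairCode (by omega) (by omega)).2 hdx)
  simpa [← Bool.not_eq_true] using hjD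

/-- A case analysis on a numbered part of a graph: the neighbours of the vertices in `hubs` are
listed there, the pairs in `star` are edges, those in `costar` are nonedges, `paths` and `ones` are
lists of vertices with few nonedges; each remaining case has a certificate of reducibility or
contradicts robustness. -/
structure CaseData where
  n : ℕ
  hubs : List (ℕ × List ℕ)
  star : List (ℕ × List ℕ) := []
  costar : List (ℕ × List ℕ) := []
  paths : List (List ℕ) := []
  ones : List (List ℕ) := []
  cuts : List (List ℕ) := []
  certs : List Cert

/-- The conditions of a case analysis that contradict its hypotheses without certificates. -/
def CaseData.terms (A : CaseData) : List Term :=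
  A.paths.flatMap pathMissing ++ A.ones.flatMap twoMissing ++
    A.cuts.map fun D => cutTerm (A.hubs.headD (0, [])) D

/-- The masks of all conditions of a case analysis, in reverse order. -/
def CaseData.masks (A : CaseData) : List (ℕ × ℕ) :=
  computeMasks (A.certs.map (Cert.masks A.hubs))
    (computeMasks (A.terms.map fun t => (codeMask t.1, codeMask t.2)) [])

/-- The case analysis is complete. -/
def CaseData.check (A : CaseData) : Bool :=
  Nat.ble A.n 10 && A.hubs.all (fun p => Nat.blt p.1 A.n && p.2.all fun i => Nat.blt i A.n) &&
  A.star.all (fun p => Nat.blt p.1 A.n && p.2.all fun i => Nat.blt i A.n) &&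
  A.costar.all (fun p => Nat.blt p.1 A.n && p.2.all fun i => Nat.blt i A.n) &&
  A.paths.all (fun l => l.all fun i => Nat.blt i A.n) &&
  A.ones.all (fun l => nodupb l && l.all fun i => Nat.blt i A.n) &&
  A.cuts.all (fun D => !D.isEmpty && Nat.ble D.length 4 && D.all fun i => Nat.blt i A.n) &&
  !A.hubs.isEmpty && A.certs.all (Cert.valid A.n A.hubs) &&
  withNat (codeMask (starCodes A.star)) fun pos => withNat (codeMask (starCodes A.costar)) fun neg =>
    -- Each branching settles a new pair and ten vertices have 45 pairs, so 200 exceeds any possible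
    -- depth.
    covers 200 pos neg A.masks.reverse

/-- A complete case analysis whose hypotheses hold contradicts the absence of reducible sets. -/
theorem CaseData.contradiction (A : CaseData) (hrob : G.IsRobust)
    (hred : ¬ ∃ V₀ : Set V, G.IsReducible V₀) {l : List V} (v : V) (hl : l.Nodup)
    (hlen : l.length = A.n)
    (hhub : A.hubs.Forall fun p => ∀ x, G.Adj (l.getD p.1 v) x → x ∈ p.2.map (l.getD · v))
    (hstar : A.star.Forall fun p => ∀ x ∈ p.2.map (l.getD · v), G.Adj (l.getD p.1 v) x)
    (hcostar : A.costar.Forall fun p => ∀ x ∈ p.2.map (l.getD · v), ¬ G.Adj (l.getD p.1 v) x)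
    (hpaths : A.paths.Forall fun B => MissingMatching G (B.map (l.getD · v)))
    (hones : A.ones.Forall fun B => AtMostOneMissing G (B.map (l.getD · v)))
    (hA : A.check = true) : False := by
  -- The default `v` plays no role: all numbers in a checked analysis are below the length of `l`.
  set f : ℕ → V := (l.getD · v) with hf
  rw [List.forall_iff_forall_mem] at hhub hstar hcostar hpaths hones
  simp only [CaseData.check, Bool.and_eq_true, List.all_eq_true, Nat.ble_eq, Nat.blt_eq,
    Bool.not_eq_true', withNat_eq] at hA
  obtain ⟨⟨⟨⟨⟨⟨⟨⟨⟨hn, hubs⟩, star⟩, costar⟩, paths⟩, ones⟩, cuts⟩, h0⟩, certs⟩, hcov⟩ := hA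
  have inj : Set.InjOn f {i | i < A.n} := by
    intro i hi j hj hij
    have hi' : i < l.length := by rw [hlen]; exact hi
    have hj' : j < l.length := by rw [hlen]; exact hj
    simp only [hf, List.getD_eq_getElem _ _ hi', List.getD_eq_getElem _ _ hj'] at hij
    exact (hl.getElem_inj_iff).1 hij
  obtain ⟨m, hm, hold⟩ := exists_holds_of_covers (CodeAdj G f) _ _ _ _ hcov (by
      intro c hc
      obtain ⟨p, hp, hc⟩ := List.mem_flatMap.1 (testBit_codeMask.1 hc)
      obtain ⟨i, hi, rfl⟩ := List.mem_map.1 hc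
      have h1 := star p hp
      have h2 := h1.2 i hi
      rw [codeAdj_pairCode (by omega) (by omega)]
      exact hstar p hp _ (List.mem_map_of_mem hi))
    (by
      intro c hc
      obtain ⟨p, hp, hc⟩ := List.mem_flatMap.1 (testBit_codeMask.1 hc)
      obtain ⟨i, hi, rfl⟩ := List.mem_map.1 hc
      have h1 := costar p hp
      have h2 := h1.2 i hi
      rw [codeAdj_pairCode (by omega) (by omega)]
      exact hcostar p hp _ (List.mem_map_of_mem hi))
  rw [List.mem_reverse, CaseData.masks, computeMasks_eq, computeMasks_eq, List.append_nil,
    List.mem_append, List.mem_reverse, List.mem_reverse, List.mem_map, List.mem_map] at hm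
  rcases hm with ⟨K, hK, rfl⟩ | ⟨t, ht, rfl⟩
  · exact hred (Cert.isReducible hn inj hubs hhub (certs K hK) hold)
  replace hold : t.Holds (CodeAdj G f) :=
    ⟨fun c hc => hold.1 c (testBit_codeMask.2 hc), fun c hc => hold.2 c (testBit_codeMask.2 hc)⟩
  simp only [CaseData.terms, List.mem_append, List.mem_flatMap, List.mem_map] at ht
  rcases ht with (⟨B, hB, ht⟩ | ⟨B, hB, ht⟩) | ⟨D, hD, rfl⟩
  · exact not_holds_of_mem_pathMissing hn inj (paths B hB) (hpaths B hB) ht hold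
  · exact not_holds_of_mem_twoMissing hn inj (nodup_of_nodupb (ones B hB).1) (ones B hB).2
      (hones B hB) ht hold
  · have hmem : A.hubs.headD (0, []) ∈ A.hubs := by
      cases h : A.hubs with
      | nil => simp [h] at h0
      | cons a b => simp
    refine not_holds_cutTerm hn hrob (hubs _ hmem) (hhub _ hmem) (cuts D hD).2 ?_
      (cuts D hD).1.2 hold
    have := (cuts D hD).1.1
    rintro rfl
    simp at this

end SimpleGraph

namespace SimpleGraph

/-! ### Families of certificates -/

/-- Entries of the first list that are not in the second. -/
def without (l s : List ℕ) : List ℕ := l.filter fun c => !memb c s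

/-- All sublists of length `k`. -/
def chooseLists : ℕ → List ℕ → List (List ℕ)
  | 0, _ => [[]]
  | _ + 1, [] => []
  | k + 1, a :: l => (chooseLists k l).map (fun s => a :: s) ++ chooseLists (k + 1) l

/-- All rearrangements of a list that move a sublist of length `k` to the front. -/
def fronts (k : ℕ) (l : List ℕ) : List (List ℕ) := (chooseLists k l).map fun s => s ++ without l s

/-- All rearrangements of a list that move `k` entries to the front in any order. -/
def orderings : ℕ → List ℕ → List (List ℕ)
  | 0, l => [l]
  | k + 1, l => l.flatMap fun a => (orderings k (without l [a])).map fun s => a :: s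

/-- All ways to split the entries of a list into `k` pairs. -/
def pairings : ℕ → List ℕ → List (List (ℕ × ℕ))
  | k + 1, a :: l => l.flatMap fun b => (pairings k (without l [b])).map fun M => (a, b) :: M
  | _, _ => [[]]

/-- The certificate for the vertex `v` given by a matching `M` in its neighbourhood, a set `Q` of
neighbours and a set `T` of triangles in the neighbourhood. -/
def vertexCert (v : ℕ) (M : List (ℕ × ℕ)) (Q : List ℕ) (T : List (ℕ × ℕ × ℕ)) : Cert where
  core := [v]
  tris := M.map (fun m => (v, m.1, m.2)) ++ T
  -- Up to repetitions the budget reads |Q| + |T| ≤ |M|: a triangle in `T` pays for two edges and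
  -- costs its three sides.
  cut := M.map (fun m => pairCode m.1 m.2) ++ Q.map (pairCode v) ++ T.flatMap sides

/-- The certificates for a vertex whose neighbourhood `N` has a matching with `k` edges and `k`
vertices that cover the other edges. -/
def coverCerts (v : ℕ) (N : List ℕ) (k : ℕ) : List Cert :=
  (chooseLists (2 * k) N).flatMap fun P => (pairings k P).flatMap fun M =>
    (chooseLists k N).map fun Q => vertexCert v M Q []

/-- Two nonneighbours of a vertex in the neighbourhood of a vertex of degree five. -/
def pathInFive : CaseData where
  n := 6
  hubs := [(0, [1, 2, 3, 4, 5])]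
  star := [(0, [1, 2, 3, 4, 5])]
  costar := [(1, [2, 3])]
  -- The only use of robustness: no neighbour is isolated in the neighbourhood.
  cuts := chooseLists 1 [1, 2, 3, 4, 5]
  certs := coverCerts 0 [1, 2, 3, 4, 5] 1 ++ coverCerts 0 [1, 2, 3, 4, 5] 2

theorem pathInFive_check : pathInFive.check = true := by decide +kernel

/-- Two nonneighbours of a vertex in the neighbourhood of a vertex of degree six. -/
def pathInSix : CaseData where
  n := 7
  hubs := [(0, [1, 2, 3, 4, 5, 6])]
  star := [(0, [1, 2, 3, 4, 5, 6])]
  costar := [(1, [2, 3])]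
  cuts := chooseLists 1 [1, 2, 3, 4, 5, 6]
  certs := coverCerts 0 [1, 2, 3, 4, 5, 6] 3 ++ coverCerts 0 [1, 2, 3, 4, 5, 6] 2 ++
    coverCerts 0 [1, 2, 3, 4, 5, 6] 1

theorem pathInSix_check : pathInSix.check = true := by decide +kernel

/-- Two disjoint nonedges in the neighbourhood of a vertex of degree five. -/
def matchingInFive : CaseData where
  n := 6
  hubs := [(0, [1, 2, 3, 4, 5])]
  star := [(0, [1, 2, 3, 4, 5])]
  costar := [(1, [2]), (3, [4])]
  paths := [[1, 2, 3, 4, 5]]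
  -- The cut consists of all eight edges of the neighbourhood, and four triangles pay for exactly
  -- eight.
  certs := [vertexCert 0 [(1, 3), (2, 4)] [] [(5, 3, 2), (5, 4, 1)]]

theorem matchingInFive_check : matchingInFive.check = true := by decide +kernel

/-- Two disjoint nonedges and a third disjoint edge in the neighbourhood of a vertex of degree
six. -/
def matchingInSix : CaseData where
  n := 7
  hubs := [(0, [1, 2, 3, 4, 5, 6])]
  star := [(0, [1, 2, 3, 4, 5, 6]), (5, [6])]
  costar := [(1, [2]), (3, [4])]
  paths := [[1, 2, 3, 4, 5, 6]]
  -- The edge to `6` disposes of all triangles through `6`, and the eight edges among the other five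
  -- neighbours are cut; with `56` this makes ten, for five triangles.
  certs := [vertexCert 0 [(1, 4), (2, 3), (5, 6)] [6] [(5, 1, 3), (5, 2, 4)]]

theorem matchingInSix_check : matchingInSix.check = true := by decide +kernel

/-- Certificates for two vertices `0` and `1` with five common neighbours `A`, based on a Fano plane
without a line. -/
def fanoCerts (A : List ℕ) (extra : List ℕ) : List Cert :=
  (fronts 2 A).flatMap fun l => match l with
    | [a, b, c, d, e] =>
      -- These are the lines of a Fano plane other than `abc`; they do not use the nonedge `ab`, and
      -- pay for twelve edges.
      [⟨[0, 1], [(0, 1, c), (0, a, d), (0, b, e), (1, a, e), (1, b, d), (c, d, e)],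
        without (pairCodes A) [pairCode a b] ++ extra⟩]
    | _ => []

/-- The certificate for two vertices with five common neighbours `A` that are pairwise adjacent. -/
def fullFanoCerts : List ℕ → List ℕ → List Cert
  | [a, b, c, d, e], extra =>
      [⟨[0, 1], [(0, 1, c), (0, a, d), (0, b, e), (1, a, e), (1, b, d), (c, d, e)],
        pairCodes [a, b, c, d, e] ++ extra⟩]
  | _, _ => []

/-- Certificates for two vertices `0` and `1` with four common neighbours `A`, two of which are not
adjacent, based on a cycle of length four. -/
def cycleCerts (A : List ℕ) (extra : List ℕ) : List Cert :=
  (fronts 2 A).flatMap fun l => match l with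
    -- The edges of the cycle `acbd` are joined alternately to `1` and `0`, which pays for eight
    -- edges and avoids `ab`.
    | [a, b, c, d] => [⟨[0, 1], [(1, a, c), (1, b, d), (0, a, d), (0, b, c)],
        without (pairCodes A) [pairCode a b] ++ extra⟩]
    | _ => []

/-- Certificates for two vertices `0` and `1` with four common neighbours `A`, based on a cycle of
length four. -/
def fullCycleCerts : List ℕ → List ℕ → List Cert
  | [a, b, c, d], extra => [⟨[0, 1], [(1, a, c), (1, b, d), (0, a, d), (0, b, c)],
        pairCodes [a, b, c, d] ++ extra⟩]
  | _, _ => []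

/-- Two adjacent vertices with the same closed neighbourhood of size seven. -/
def twinsSix : CaseData where
  n := 7
  hubs := [(0, [1, 2, 3, 4, 5, 6]), (1, [0, 2, 3, 4, 5, 6])]
  star := [(0, [1, 2, 3, 4, 5, 6]), (1, [0, 2, 3, 4, 5, 6])]
  ones := [[2, 3, 4, 5, 6]]
  certs := fanoCerts [2, 3, 4, 5, 6] (starCodes [(0, [1])]) ++
    fullFanoCerts [2, 3, 4, 5, 6] (starCodes [(0, [1])])

theorem twinsSix_check : twinsSix.check = true := by decide +kernel

/-- A vertex of degree seven that subsumes a vertex of degree six. -/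
def sevenOverSix : CaseData where
  n := 8
  hubs := [(0, [1, 2, 3, 4, 5, 6, 7]), (1, [0, 2, 3, 4, 5, 6])]
  star := [(0, [1, 2, 3, 4, 5, 6, 7]), (1, [0, 2, 3, 4, 5, 6])]
  ones := [[2, 3, 4, 5, 6]]
  -- Even if the common neighbours are pairwise adjacent, their ten edges together with `01` and
  -- `07` just fit the budget of twelve.
  certs := fanoCerts [2, 3, 4, 5, 6] (starCodes [(0, [1, 7])]) ++
    fullFanoCerts [2, 3, 4, 5, 6] (starCodes [(0, [1, 7])])

theorem sevenOverSix_check : sevenOverSix.check = true := by decide +kernel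

/-- A vertex of degree seven adjacent to a thin vertex of degree six. -/
def sevenThin : CaseData where
  n := 9
  hubs := [(0, [1, 2, 3, 4, 5, 7, 8]), (1, [0, 2, 3, 4, 5, 6])]
  star := [(0, [1, 2, 3, 4, 5, 7, 8]), (1, [0, 2, 3, 4, 5, 6]), (2, [4, 5]), (3, [4, 5])]
  costar := [(2, [3]), (4, [5])]
  -- The two nonedges leave only a four-cycle to cut, so the budget of eight also covers `01`, `07`,
  -- `08` and `16`.
  certs := [⟨[0, 1], [(1, 2, 4), (1, 3, 5), (0, 2, 5), (0, 3, 4)],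
    starCodes [(2, [4, 5]), (3, [4, 5]), (0, [1, 7, 8]), (1, [6])]⟩]

theorem sevenThin_check : sevenThin.check = true := by decide +kernel

/-- Two adjacent vertices of degree six with four common neighbours. -/
def sixSix : CaseData where
  n := 8
  hubs := [(0, [1, 2, 3, 4, 5, 6]), (1, [0, 2, 3, 4, 5, 7])]
  star := [(0, [1, 2, 3, 4, 5, 6]), (1, [0, 2, 3, 4, 5, 7]), (6, [2, 3, 4, 5]), (7, [2, 3, 4, 5])]
  paths := [[2, 3, 4, 5]]
  -- A nonedge brings the cut down to the eight edges that four triangles allow. Without one, two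
  -- more triangles are found with the help of the private neighbours `6` and `7`, and the cut has
  -- eleven edges.
  certs := cycleCerts [2, 3, 4, 5] (starCodes [(0, [1, 6]), (1, [7])]) ++
    [⟨[0, 1], [(0, 6, 2), (0, 3, 4), (0, 1, 5), (1, 7, 3), (1, 2, 4), (2, 3, 5)],
      pairCodes [2, 3, 4, 5] ++ starCodes [(0, [1, 6]), (1, [7]), (6, [2]), (7, [3])]⟩]

theorem sixSix_check : sixSix.check = true := by decide +kernel

/-- A vertex of degree six adjacent to a vertex of degree five with four common neighbours. -/
def sixFive : CaseData where
  n := 7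
  hubs := [(0, [1, 2, 3, 4, 5, 6]), (1, [0, 2, 3, 4, 5])]
  star := [(0, [1, 2, 3, 4, 5, 6]), (1, [0, 2, 3, 4, 5])]
  paths := [[2, 3, 4, 5]]
  certs := cycleCerts [2, 3, 4, 5] (starCodes [(0, [1, 6])]) ++
    fullCycleCerts [2, 3, 4, 5] (starCodes [(0, [1, 6])])

theorem sixFive_check : sixFive.check = true := by decide +kernel

/-- Two adjacent vertices with the same closed neighbourhood of size six. -/
def twinsFive : CaseData where
  n := 6
  hubs := [(0, [1, 2, 3, 4, 5]), (1, [0, 2, 3, 4, 5])]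
  star := [(0, [1, 2, 3, 4, 5]), (1, [0, 2, 3, 4, 5])]
  paths := [[2, 3, 4, 5]]
  certs := cycleCerts [2, 3, 4, 5] (starCodes [(0, [1])]) ++
    fullCycleCerts [2, 3, 4, 5] (starCodes [(0, [1])])

theorem twinsFive_check : twinsFive.check = true := by decide +kernel

/-- Two adjacent vertices of degree five with three common neighbours. -/
def fiveFive : CaseData where
  n := 7
  hubs := [(0, [1, 2, 3, 4, 5]), (1, [0, 2, 3, 4, 6])]
  star := [(0, [1, 2, 3, 4, 5]), (1, [0, 2, 3, 4, 6]), (5, [2, 3, 4]), (6, [2, 3, 4]), (2, [3, 4]),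
    (3, [4])]
  certs := [⟨[0, 1], [(0, 5, 2), (0, 3, 4), (1, 6, 3), (1, 2, 4)],
    starCodes [(5, [2]), (3, [4]), (6, [3]), (2, [3, 4]), (0, [1, 5]), (1, [6])]⟩]

theorem fiveFive_check : fiveFive.check = true := by decide +kernel

/-- A vertex of degree seven that subsumes a vertex of degree five. -/
def sevenOverFive : CaseData where
  n := 8
  hubs := [(0, [1, 2, 3, 4, 5, 6, 7]), (1, [0, 2, 3, 4, 5])]
  star := [(0, [1, 2, 3, 4, 5, 6, 7]), (1, [0, 2, 3, 4, 5])]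
  costar := [(1, [6, 7])]
  ones := [[2, 3, 4, 5]]
  -- Robustness provides an edge from `6` or `7` to one of the common neighbours.
  cuts := [[6, 7]]
  certs := cycleCerts [2, 3, 4, 5] (starCodes [(0, [1, 6, 7])]) ++
    [6, 7].flatMap fun w => (fronts 1 [2, 3, 4, 5]).flatMap fun l => match l with
      -- The first four triangles are alternate faces of the octahedron with opposite pairs `0a`,
      -- `1b`, `cd`. The edge `0a` remains free for the fifth, which meets the cost of ten.
      | [a, b, c, d] => [⟨[0, 1], [(a, b, c), (1, d, a), (0, d, b), (0, 1, c), (0, w, a)],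
          pairCodes [2, 3, 4, 5] ++ starCodes [(0, [1, 6, 7]), (w, [a])]⟩]
      | _ => []

theorem sevenOverFive_check : sevenOverFive.check = true := by decide +kernel

/-- Four triangles on the vertices `0`, `1`, `a`, `b`, `c`, `d` that avoid the edges `0a`, `1b` and
`cd`. -/
def fourFaces (a b c d : ℕ) : List (ℕ × ℕ × ℕ) := [(0, 1, c), (0, b, d), (a, 1, d), (a, b, c)]

/-- Certificates for a vertex `0` of degree eight that subsumes the vertex `1` of degree five with
further neighbours `a`, `b`, `c`, `d`; the remaining neighbours of `0` are `u`, `w` and `z`. -/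
def eightCerts (A : List ℕ) : List Cert :=
  -- Here two private neighbours of `0` are adjacent. The extra triangle on them suffices if there
  -- is a nonedge in `A`; otherwise an edge from the third one to `A` gives another.
  ((fronts 2 [6, 7, 8]).flatMap fun l => match l with
    | [u, w, z] =>
      ((fronts 1 A).flatMap fun m => match m with
        | [a, b, c, d] => [⟨[0, 1], fourFaces a b c d ++ [(0, u, w), (0, z, a)],
            pairCodes A ++ starCodes [(0, [1, 6, 7, 8]), (u, [w]), (z, [a])]⟩]
        | _ => []) ++
      (fronts 2 A).flatMap fun m => match m with
        | [c, d, a, b] => [⟨[0, 1], fourFaces a b c d ++ [(0, u, w)],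
            without (pairCodes A) [pairCode c d] ++ starCodes [(0, [1, 6, 7, 8]), (u, [w])]⟩]
        | _ => []
    | _ => []) ++
  -- Either cutting `0w` disposes of all triangles at `0` through private neighbours, or a nonedge
  -- `cd` makes a single extra triangle `0wa` sufficient.
  ([6, 7, 8].flatMap fun w =>
    fullCycleCerts A (starCodes [(0, [1, w])]) ++
    (orderings 2 A).flatMap fun m => match m with
      | [a, b, c, d] => [⟨[0, 1], fourFaces a b c d ++ [(0, w, a)],
          without (pairCodes A) [pairCode c d] ++ starCodes [(0, [1, 6, 7, 8]), (w, [a])]⟩]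
      | _ => []) ++
  -- For pairwise nonadjacent private neighbours that, together with `1`, are matched onto `A`:
  -- cutting the edges from `0` to `A` is then enough.
  ((orderings 3 A).flatMap fun m => match m with
    | [a, b, c, d] => [vertexCert 0 [(6, a), (7, b), (8, c), (1, d)] A []]
    | _ => []) ++
  -- The remaining cases, in which few edges join the private neighbours to `A`, so that fewer edges
  -- at `0` need to be cut.
  (fronts 1 [6, 7, 8]).flatMap fun l => match l with
    | [z, u, w] => (orderings 2 A).flatMap fun m => match m with
      | [a, b, c, d] =>
        [⟨[0, 1], fourFaces a b c d ++ [(0, u, a)],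
          pairCodes A ++ starCodes [(0, [1, a, z]), (u, [a])]⟩,
        vertexCert 0 [(u, a), (1, c), (b, d)] [a, 1, c] [],
        vertexCert 0 [(u, a), (w, b), (c, d)] [a, b, 1] []]
      | _ => []
    | _ => []

/-- A vertex of degree eight that subsumes a vertex of degree five. -/
def eightOverFive : CaseData where
  n := 9
  hubs := [(0, [1, 2, 3, 4, 5, 6, 7, 8]), (1, [0, 2, 3, 4, 5])]
  star := [(0, [1, 2, 3, 4, 5, 6, 7, 8]), (1, [0, 2, 3, 4, 5])]
  costar := [(1, [6, 7, 8])]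
  ones := [[2, 3, 4, 5]]
  cuts := chooseLists 1 [6, 7, 8] ++ chooseLists 2 [6, 7, 8] ++ chooseLists 3 [6, 7, 8]
  certs := eightCerts [2, 3, 4, 5]

theorem eightOverFive_check : eightOverFive.check = true := by decide +kernel

/-- A certificate for a vertex `0` of degree nine that subsumes three of its neighbours. -/
def nineCert (tris : List (ℕ × ℕ × ℕ)) : Cert :=
  -- Ten pairs of high neighbours and four edges to low ones meet all triangles at the core; seven
  -- triangles pay for these fourteen.
  ⟨[0, 1, 2, 3], tris, pairCodes [4, 5, 6, 7, 8] ++ starCodes [(0, [1, 2, 3, 9])]⟩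

/-- Three vertices subsumed by a vertex of degree nine that have four common neighbours with it,
none of which is `4`. -/
def nineSame : CaseData where
  n := 10
  hubs := [(0, [1, 2, 3, 4, 5, 6, 7, 8, 9]), (1, [0, 4, 5, 6, 7, 8]), (2, [0, 4, 5, 6, 7, 8]),
    (3, [0, 4, 5, 6, 7, 8])]
  star := [(0, [1, 2, 3, 4, 5, 6, 7, 8, 9]), (1, [5, 6, 7, 8]), (2, [5, 6, 7, 8]),
    (3, [5, 6, 7, 8])]
  ones := [[5, 6, 7, 8]]
  certs := (orderings 2 [5, 6, 7, 8]).flatMap fun l => match l with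
    | [x, y, z, w] =>
      -- If `4` has no neighbour among the other four, six triangles exceed the cost of ten.
      -- Otherwise an edge `4c` gives the seventh; `c` differs from `x` since the edge `0x` is in
      -- use.
      ⟨[0, 1, 2, 3], [(1, x, z), (1, y, w), (2, x, w), (2, y, z), (3, z, w), (0, 3, x)],
        pairCodes [5, 6, 7, 8] ++ starCodes [(0, [1, 2, 3, 9])]⟩ ::
      [y, z, w].map fun c => nineCert
        [(1, x, z), (1, y, w), (2, x, w), (2, y, z), (3, z, w), (0, 3, x), (0, 4, c)]
    | _ => []

theorem nineSame_check : nineSame.check = true := by decide +kernel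

/-- Three vertices subsumed by a vertex of degree nine that have four common neighbours with it:
two of them avoid `4` and the third avoids `5`. -/
def nineTwo : CaseData where
  n := 10
  hubs := [(0, [1, 2, 3, 4, 5, 6, 7, 8, 9]), (1, [0, 4, 5, 6, 7, 8]), (2, [0, 4, 5, 6, 7, 8]),
    (3, [0, 4, 5, 6, 7, 8])]
  star := [(0, [1, 2, 3, 4, 5, 6, 7, 8, 9]), (1, [5, 6, 7, 8]), (2, [5, 6, 7, 8]),
    (3, [4, 6, 7, 8])]
  ones := [[5, 6, 7, 8], [4, 6, 7, 8]]
  certs := (orderings 2 [6, 7, 8]).flatMap fun l => match l with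
    | [d, e, f] =>
      [nineCert [(1, 5, d), (1, e, f), (2, 5, e), (2, d, f), (3, 4, f), (3, d, e), (0, 4, d)],
      nineCert [(1, 5, d), (1, e, f), (2, 5, e), (2, d, f), (3, 4, d), (0, 4, e), (0, 3, f)]]
    | _ => []

theorem nineTwo_check : nineTwo.check = true := by decide +kernel

/-- Three vertices subsumed by a vertex of degree nine that have four common neighbours with it and
avoid `4`, `5` and `6`. -/
def nineDistinct : CaseData where
  n := 10
  hubs := [(0, [1, 2, 3, 4, 5, 6, 7, 8, 9]), (1, [0, 4, 5, 6, 7, 8]), (2, [0, 4, 5, 6, 7, 8]),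
    (3, [0, 4, 5, 6, 7, 8])]
  star := [(0, [1, 2, 3, 4, 5, 6, 7, 8, 9]), (1, [5, 6, 7, 8]), (2, [4, 6, 7, 8]),
    (3, [4, 5, 7, 8])]
  ones := [[5, 6, 7, 8], [4, 6, 7, 8], [4, 5, 7, 8]]
  certs := [(7, 8), (8, 7)].flatMap fun p => match p with
    | (g, h) =>
      [nineCert [(1, 5, g), (1, 6, h), (2, 6, g), (2, 4, h), (3, 4, g), (3, 5, h), (0, g, h)],
      nineCert [(1, 5, g), (1, 6, h), (2, 6, g), (2, 4, h), (3, 4, g), (3, 5, h), (0, 4, 5)],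
      nineCert [(1, 5, 6), (1, 7, 8), (3, 4, g), (3, 5, h), (2, 4, h), (2, 6, g), (0, 4, 5)],
      nineCert [(2, 4, 6), (2, 7, 8), (3, 4, h), (3, 5, g), (1, 5, h), (1, 6, g), (0, 4, 5)],
      nineCert [(1, 5, 6), (1, 7, 8), (2, 4, g), (2, 6, h), (3, 4, h), (3, 5, g), (0, 4, 6)]]

theorem nineDistinct_check : nineDistinct.check = true := by decide +kernel

end SimpleGraph

namespace SimpleGraph

/-! ### Vertices of small degree -/

/-- The elements of a finite set, with some prescribed elements first. -/
theorem exists_list_of_subset {V : Type*} [DecidableEq V] {C : Finset V} {pre : List V} (hpre : pre.Nodup)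
    (hC : ∀ x ∈ pre, x ∈ C) : ∃ l : List V, (pre ++ l).Nodup ∧ (∀ x, x ∈ C ↔ x ∈ pre ++ l) ∧
      pre.length + l.length = C.card := by
  have hmem : ∀ x, x ∈ C ↔ x ∈ pre ++ (C \ pre.toFinset).toList := by
    intro x
    simp only [List.mem_append, Finset.mem_toList, Finset.mem_sdiff, List.mem_toFinset]
    by_cases hx : x ∈ pre
    · simp [hx, hC x hx]
    · simp [hx]
  have hnd : (pre ++ (C \ pre.toFinset).toList).Nodup := by
    refine List.Nodup.append hpre (Finset.nodup_toList _) fun x hx hx' => ?_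
    rw [Finset.mem_toList, Finset.mem_sdiff, List.mem_toFinset] at hx'
    exact hx'.2 hx
  refine ⟨_, hnd, hmem, ?_⟩
  rw [← List.length_append, ← List.toFinset_card_of_nodup hnd]
  congr 1
  ext x
  rw [List.mem_toFinset, hmem]

section

variable {V : Type*} [Fintype V] [DecidableEq V] {G : SimpleGraph V} [DecidableRel G.Adj]

/-- The neighbours of a vertex, with some prescribed neighbours first. -/
theorem exists_neighbor_list (v : V) {pre : List V} (hpre : pre.Nodup)
    (hadj : ∀ x ∈ pre, G.Adj v x) : ∃ l : List V, (v :: (pre ++ l)).Nodup ∧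
      (∀ x, G.Adj v x ↔ x ∈ pre ++ l) ∧ pre.length + l.length = G.degree v := by
  obtain ⟨l, hnd, hmem, hlen⟩ := exists_list_of_subset hpre (C := G.neighborFinset v)
    fun x hx => (mem_neighborFinset _ _ _).2 (hadj x hx)
  have hN : ∀ x, G.Adj v x ↔ x ∈ pre ++ l := fun x => by rw [← hmem, mem_neighborFinset]
  exact ⟨l, List.nodup_cons.2 ⟨fun h => G.irrefl ((hN v).2 h), hnd⟩, hN,
    hlen.trans (card_neighborFinset_eq_degree _ _)⟩

/-- An isolated vertex is reducible without any triangle or cut edge, and a nonempty neighbourhood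
contains a component with five vertices. -/
theorem degree_eq_five_or_six (hrob : G.IsRobust) (hred : ¬ ∃ V₀ : Set V, G.IsReducible V₀) {v : V}
    (hv : G.degree v ≤ 6) : G.degree v = 5 ∨ G.degree v = 6 := by
  by_contra hne
  have h4 : G.degree v ≤ 4 := by omega
  rcases Nat.eq_zero_or_pos (G.degree v) with h0 | hpos
  · refine hred ⟨{v}, ∅, ∅, ?_⟩
    have hno : ∀ x, ¬ G.Adj v x := fun x hx => by
      have : x ∈ G.neighborFinset v := (mem_neighborFinset _ _ _).2 hx
      rw [← card_neighborFinset_eq_degree, Finset.card_eq_zero] at h0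
      simp [h0] at this
    refine ⟨Set.singleton_nonempty v, by simp, by simp, by simp, by simp, ?_, by simp⟩
    intro T hT w hw hwT
    rw [Set.mem_singleton_iff] at hw
    subst hw
    have hc : 1 < T.card := by rw [hT.2]; norm_num
    obtain ⟨x, hx, hxw⟩ := Finset.exists_mem_ne hc w
    exact hno x ((G.deleteEdges_le _) (hT.1 hwT hx hxw.symm))
  · obtain ⟨d, hd, x, hx, hvx, -⟩ := hrob.exists_adj (v := v) (D := G.neighborFinset v)
      (fun d hd => (mem_neighborFinset _ _ _).1 hd)
      (by rw [← Finset.card_pos, card_neighborFinset_eq_degree]; exact hpos)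
      (by rw [card_neighborFinset_eq_degree]; exact h4)
    exact hx ((mem_neighborFinset _ _ _).2 hvx)

/-- The complement of the neighbourhood of a `6⁻`-vertex has maximum degree at most one. -/
theorem adj_or_adj_of_degree_le_six (hrob : G.IsRobust)
    (hred : ¬ ∃ V₀ : Set V, G.IsReducible V₀) {v x y z : V} (hv : G.degree v ≤ 6)
    (hx : G.Adj v x) (hy : G.Adj v y) (hz : G.Adj v z) (hxy : x ≠ y) (hxz : x ≠ z) (hyz : y ≠ z) :
    G.Adj x y ∨ G.Adj x z := by
  by_contra! hcon
  obtain ⟨l, hnd, hN, hlen⟩ := exists_neighbor_list (G := G) v (pre := [x, y, z])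
    (by simp [hxy, hxz, hyz]) (by simp [hx, hy, hz])
  have hco : ∀ w ∈ [y, z], ¬ G.Adj x w := by simpa using hcon
  rcases degree_eq_five_or_six hrob hred hv with h | h
  · match l, hnd, hN, hlen with
    | [a, b], hnd, hN, _ =>
      exact pathInFive.contradiction hrob hred v hnd rfl (fun w hw => (hN w).1 hw)
        (fun w hw => (hN w).2 hw) hco trivial trivial pathInFive_check
    | [], _, _, hlen | [_], _, _, hlen | _ :: _ :: _ :: _, _, _, hlen => simp [h] at hlen; try omega
  · match l, hnd, hN, hlen with
    | [a, b, c], hnd, hN, _ =>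
      exact pathInSix.contradiction hrob hred v hnd rfl (fun w hw => (hN w).1 hw)
        (fun w hw => (hN w).2 hw) hco trivial trivial pathInSix_check
    | [], _, _, hlen | [_], _, _, hlen | [_, _], _, _, hlen | _ :: _ :: _ :: _ :: _, _, _, hlen =>
      simp [h] at hlen; try omega

end
end SimpleGraph

/-! ### Nonedges in the neighbourhood of a $6^-$-vertex -/

namespace SimpleGraph

section

variable {V : Type*} [Fintype V] [DecidableEq V] {G : SimpleGraph V} [DecidableRel G.Adj]

theorem missingMatching_of_degree_le_six (hrob : G.IsRobust)
    (hred : ¬ ∃ V₀ : Set V, G.IsReducible V₀) {v : V} (hv : G.degree v ≤ 6) {l : List V}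
    (hl : ∀ x ∈ l, G.Adj v x) : MissingMatching G l :=
  fun x hx y hy z hz => adj_or_adj_of_degree_le_six hrob hred hv (hl x hx) (hl y hy) (hl z hz)

/-- The neighbourhood of a `5`-vertex has no two disjoint nonedges. -/
theorem adj_or_adj_of_degree_eq_five (hrob : G.IsRobust)
    (hred : ¬ ∃ V₀ : Set V, G.IsReducible V₀) {v x y z w : V} (hv : G.degree v = 5)
    (hadj : ∀ t ∈ [x, y, z, w], G.Adj v t) (hnd : [x, y, z, w].Nodup) :
    G.Adj x y ∨ G.Adj z w := by
  by_contra! hcon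
  obtain ⟨l, hnd, hN, hlen⟩ := exists_neighbor_list (G := G) v hnd hadj
  match l, hnd, hN, hlen with
  | [a], hnd, hN, _ =>
    exact matchingInFive.contradiction hrob hred v hnd rfl (fun w hw => (hN w).1 hw)
      (fun w hw => (hN w).2 hw)
      ⟨fun t ht => List.mem_singleton.1 ht ▸ hcon.1, fun t ht => List.mem_singleton.1 ht ▸ hcon.2⟩
      (missingMatching_of_degree_le_six hrob hred (by omega) fun t ht => (hN t).2 ht) trivial
      matchingInFive_check
  | [], _, _, hlen | _ :: _ :: _, _, _, hlen => simp [hv] at hlen; try omega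

/-- If the neighbourhood of a `6`-vertex has two disjoint nonedges, then the remaining two vertices
are not adjacent either. -/
theorem not_adj_of_degree_eq_six (hrob : G.IsRobust)
    (hred : ¬ ∃ V₀ : Set V, G.IsReducible V₀) {v x y z w p q : V} (hv : G.degree v = 6)
    (hadj : ∀ t ∈ [x, y, z, w, p, q], G.Adj v t) (hnd : [x, y, z, w, p, q].Nodup)
    (hxy : ¬ G.Adj x y) (hzw : ¬ G.Adj z w) : ¬ G.Adj p q := by
  intro hpq
  obtain ⟨l, hnd, hN, hlen⟩ := exists_neighbor_list (G := G) v hnd hadj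
  match l, hnd, hN, hlen with
  | [], hnd, hN, _ =>
    exact matchingInSix.contradiction hrob hred v hnd rfl (fun w hw => (hN w).1 hw)
      ⟨fun w hw => (hN w).2 hw, fun t ht => List.mem_singleton.1 ht ▸ hpq⟩
      ⟨fun t ht => List.mem_singleton.1 ht ▸ hxy, fun t ht => List.mem_singleton.1 ht ▸ hzw⟩
      (missingMatching_of_degree_le_six hrob hred (by omega) fun t ht => (hN t).2 ht) trivial
      matchingInSix_check
  | _ :: _, _, _, hlen => simp [hv] at hlen

/-- Two disjoint nonedges force a third on the remaining pair. This excludes exactly two nonedges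
and determines the neighbourhood of a thin vertex. -/
theorem exists_nonedge_of_degree_eq_six (hrob : G.IsRobust)
    (hred : ¬ ∃ V₀ : Set V, G.IsReducible V₀) {v x y z w : V} (hv : G.degree v = 6)
    (hadj : ∀ t ∈ [x, y, z, w], G.Adj v t) (hnd : [x, y, z, w].Nodup)
    (hxy : ¬ G.Adj x y) (hzw : ¬ G.Adj z w) :
    ∃ p q, (v :: [x, y, z, w, p, q]).Nodup ∧ (∀ t, G.Adj v t ↔ t ∈ [x, y, z, w, p, q]) ∧
      ¬ G.Adj p q := by
  obtain ⟨l, hnd, hN, hlen⟩ := exists_neighbor_list (G := G) v hnd hadj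
  match l, hnd, hN, hlen with
  | [p, q], hnd, hN, _ =>
    exact ⟨p, q, hnd, hN, not_adj_of_degree_eq_six hrob hred hv (fun t ht => (hN t).2 ht)
      (List.nodup_cons.1 hnd).2 hxy hzw⟩
  | [], _, _, hlen | [_], _, _, hlen | _ :: _ :: _ :: _, _, _, hlen =>
    simp [hv] at hlen; try omega

theorem complement_maxDegree_le_one (hrob : G.IsRobust)
    (hred : ¬ ∃ V₀ : Set V, G.IsReducible V₀) {v : V} (hv : G.degree v ≤ 6) :
    ((G.nbhdGraph v)ᶜ).maxDegree ≤ 1 := by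
  refine maxDegree_le_of_forall_degree_le _ _ fun x => ?_
  rw [← card_neighborFinset_eq_degree, Finset.card_le_one]
  intro y hy z hz
  rw [mem_neighborFinset, compl_adj] at hy hz
  by_contra hyz
  rcases adj_or_adj_of_degree_le_six hrob hred hv x.2 y.2 z.2 (fun h => hy.1 (Subtype.ext h))
    (fun h => hz.1 (Subtype.ext h)) (fun h => hyz (Subtype.ext h)) with h | h
  · exact hy.2 h
  · exact hz.2 h

/-- Two nonedges would be disjoint; at a $5$-vertex this is impossible, and at a $6$-vertex there
would be a third. -/
theorem complement_card_edgeFinset_ne_two (hrob : G.IsRobust)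
    (hred : ¬ ∃ V₀ : Set V, G.IsReducible V₀) {v : V} (hv : G.degree v ≤ 6) :
    ((G.nbhdGraph v)ᶜ).edgeFinset.card ≠ 2 := by
  intro h2
  obtain ⟨e, f, hef, heq⟩ := Finset.card_eq_two.1 h2
  have hmem : ∀ e' : Sym2 (G.neighborSet v), e' ∈ ((G.nbhdGraph v)ᶜ).edgeSet ↔ e' = e ∨ e' = f := by
    intro e'
    rw [← mem_edgeFinset, heq, Finset.mem_insert, Finset.mem_singleton]
  have he := (hmem e).2 (Or.inl rfl)
  have hf := (hmem f).2 (Or.inr rfl)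
  induction e with
  | _ x y =>
  induction f with
  | _ z w =>
  obtain ⟨x, hx⟩ := x
  obtain ⟨y, hy⟩ := y
  obtain ⟨z, hz⟩ := z
  obtain ⟨w, hw⟩ := w
  rw [mem_neighborSet] at hx hy hz hw
  simp only [mem_edgeSet, compl_adj, ne_eq, Subtype.mk.injEq, comap_adj,
    Function.Embedding.subtype_apply] at he hf
  have key := fun {a b c : V} (ha : G.Adj v a) (hb : G.Adj v b) (hc : G.Adj v c) =>
    adj_or_adj_of_degree_le_six (x := a) (y := b) (z := c) hrob hred hv ha hb hc
  simp only [ne_eq, Sym2.eq_iff, Subtype.mk.injEq, not_or, not_and] at hef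
  have hyx : ¬ G.Adj y x := fun h => he.2 h.symm
  have hwz : ¬ G.Adj w z := fun h => hf.2 h.symm
  have hxz : x ≠ z := by
    rintro rfl
    rcases key hx hy hw he.1 hf.1 (hef.1 rfl) with h | h
    exacts [he.2 h, hf.2 h]
  have hxw : x ≠ w := by
    rintro rfl
    rcases key hx hy hz he.1 (Ne.symm hf.1) (hef.2 rfl) with h | h
    exacts [he.2 h, hwz h]
  have hyz : y ≠ z := by
    rintro rfl
    rcases key hy hx hw (Ne.symm he.1) hf.1 hxw with h | h
    exacts [hyx h, hf.2 h]
  have hyw : y ≠ w := by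
    rintro rfl
    rcases key hy hx hz (Ne.symm he.1) (Ne.symm hf.1) hxz with h | h
    exacts [hyx h, hwz h]
  have hnd : [x, y, z, w].Nodup := by
    simp [hxz, hxw, hyz, hyw, he.1, hf.1]
  have hadj : ∀ t ∈ [x, y, z, w], G.Adj v t := by simp [hx, hy, hz, hw]
  rcases degree_eq_five_or_six hrob hred hv with h | h
  · rcases adj_or_adj_of_degree_eq_five hrob hred h hadj hnd with h | h
    exacts [he.2 h, hf.2 h]
  · obtain ⟨p, q, hnd, hN, hpq⟩ := exists_nonedge_of_degree_eq_six hrob hred h hadj hnd he.2 hf.2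
    have hp : G.Adj v p := (hN p).2 (by simp)
    have hq : G.Adj v q := (hN q).2 (by simp)
    simp only [List.nodup_cons, List.mem_cons, List.not_mem_nil, or_false, not_or] at hnd
    obtain ⟨-, ⟨-, -, -, hxp, -⟩, ⟨-, -, hyp, -⟩, ⟨-, hzp, -⟩, ⟨hwp, -⟩, hpq', -⟩ := hnd
    have := (hmem s(⟨p, hp⟩, ⟨q, hq⟩)).1
      ⟨fun h => hpq' (congrArg Subtype.val h), hpq⟩
    rcases this with h | h
    · have : s(p, q) = s(x, y) := congrArg (Sym2.map Subtype.val) h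
      rcases Sym2.mem_iff.1 (this ▸ Sym2.mem_mk_left p q : p ∈ s(x, y)) with h | h
      exacts [hxp h.symm, hyp h.symm]
    · have : s(p, q) = s(z, w) := congrArg (Sym2.map Subtype.val) h
      rcases Sym2.mem_iff.1 (this ▸ Sym2.mem_mk_left p q : p ∈ s(z, w)) with h | h
      exacts [hzp h.symm, hwp h.symm]

/-- If a `6⁻`-vertex is subsumed, its neighbourhood has at most one nonedge. -/
theorem atMostOneMissing_of_subsumes (hrob : G.IsRobust)
    (hred : ¬ ∃ V₀ : Set V, G.IsReducible V₀) {u v : V} (hv : G.degree v ≤ 6)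
    (huv : G.Subsumes u v) {l : List V} (hl : ∀ x ∈ l, G.Adj v x) : AtMostOneMissing G l := by
  rw [subsumes_iff] at huv
  intro x hx y hy z hz w hw hxy hzw nxy nzw
  replace hx := hl x hx
  replace hy := hl y hy
  replace hz := hl z hz
  replace hw := hl w hw
  have key := fun {a b c : V} (ha : G.Adj v a) (hb : G.Adj v b) (hc : G.Adj v c) =>
    adj_or_adj_of_degree_le_six (x := a) (y := b) (z := c) hrob hred hv ha hb hc
  have nyx : ¬ G.Adj y x := fun h => nxy h.symm
  have nwz : ¬ G.Adj w z := fun h => nzw h.symm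
  by_contra hne
  simp only [Sym2.eq_iff, not_or, not_and] at hne
  have hxz : x ≠ z := by
    rintro rfl
    rcases key hx hy hw hxy hzw (hne.1 rfl) with h | h
    exacts [nxy h, nzw h]
  have hxw : x ≠ w := by
    rintro rfl
    rcases key hx hy hz hxy hzw.symm (hne.2 rfl) with h | h
    exacts [nxy h, nwz h]
  have hyz : y ≠ z := by
    rintro rfl
    rcases key hy hx hw hxy.symm hzw hxw with h | h
    exacts [nyx h, nzw h]
  have hyw : y ≠ w := by
    rintro rfl
    rcases key hy hx hz hxy.symm hzw.symm hxz with h | h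
    exacts [nyx h, nwz h]
  rcases degree_eq_five_or_six hrob hred hv with h | h
  · rcases adj_or_adj_of_degree_eq_five hrob hred (x := x) (y := y) (z := z) (w := w) h
      (by simp [hx, hy, hz, hw]) (by simp [hxz, hxw, hyz, hyw, hxy, hzw]) with h | h
    exacts [nxy h, nzw h]
  -- The subsuming vertex lies on no nonedge, so it is one of the two remaining neighbours and is
  -- adjacent to the other, though these two should not be adjacent.
  · have hu : ∀ a b, G.Adj v a → a ≠ b → ¬ G.Adj b a → u ≠ b := by
      rintro a b ha hab hba rfl
      exact hba (huv.2 a ha hab)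
    obtain ⟨l, hnd, hN, hlen⟩ := exists_neighbor_list (G := G) v (pre := [x, y, z, w, u])
      (by
        simp [hxz, hxw, hyz, hyw, hxy, hzw, (hu y x hy hxy.symm nxy).symm,
          (hu x y hx hxy nyx).symm, (hu w z hw hzw.symm nzw).symm, (hu z w hz hzw nwz).symm])
      (by simp [hx, hy, hz, hw, huv.1])
    match l, hnd, hN, hlen with
    | [q], hnd, hN, _ =>
      refine not_adj_of_degree_eq_six hrob hred h (fun t ht => (hN t).2 ht)
        (List.nodup_cons.1 hnd).2 nxy nzw (huv.2 q ((hN q).2 (by simp)) ?_)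
      rintro rfl
      simp at hnd
    | [], _, _, hlen | _ :: _ :: _, _, _, hlen => simp [h] at hlen; try omega

end
end SimpleGraph

/-! ### Adjacency and subsumption for vertices of degree at most eight -/

namespace SimpleGraph

section

variable {V : Type*} [Fintype V] [DecidableEq V] {G : SimpleGraph V} [DecidableRel G.Adj]

/-- Lists of the common neighbours of two adjacent vertices and of the other neighbours of each. -/
theorem exists_common_neighbor_lists {u v : V} (huv : G.Adj u v) : ∃ A P Q : List V,
    (u :: v :: (A ++ P)).Nodup ∧ (u :: v :: (A ++ Q)).Nodup ∧
    (∀ x, G.Adj u x ↔ x ∈ v :: (A ++ P)) ∧ (∀ x, G.Adj v x ↔ x ∈ u :: (A ++ Q)) ∧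
    (∀ x ∈ P, ¬ G.Adj v x) ∧ (∀ x ∈ Q, ¬ G.Adj u x) ∧
    1 + A.length + P.length = G.degree u ∧ 1 + A.length + Q.length = G.degree v := by
  have aux : ∀ {u v : V}, G.Adj u v → ∀ {A : List V}, A.Nodup →
      (∀ x, x ∈ A ↔ G.Adj u x ∧ G.Adj v x) → ∃ P : List V, (u :: v :: (A ++ P)).Nodup ∧
        (∀ x, G.Adj u x ↔ x ∈ v :: (A ++ P)) ∧ (∀ x ∈ P, ¬ G.Adj v x) ∧
        1 + A.length + P.length = G.degree u := by
    intro u v huv A hA hmem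
    have hvA : v ∉ A := fun h => G.irrefl ((hmem v).1 h).2
    obtain ⟨l, hnd, hN, hlen⟩ := exists_neighbor_list (G := G) u (pre := v :: A)
      (List.nodup_cons.2 ⟨hvA, hA⟩) (by
        intro x hx
        rcases List.mem_cons.1 hx with rfl | hx
        · exact huv
        · exact ((hmem x).1 hx).1)
    refine ⟨l, hnd, hN, fun x hx h => ?_, by rw [← hlen, List.length_cons]; omega⟩
    have hux : G.Adj u x := (hN x).2 (List.mem_append_right _ hx)
    have := (List.nodup_append'.1 (List.nodup_cons.1 hnd).2).2.2
    exact this (List.mem_cons_of_mem _ ((hmem x).2 ⟨hux, h⟩)) hx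
  have hmem : ∀ x, x ∈ (G.neighborFinset u ∩ G.neighborFinset v).toList ↔
      G.Adj u x ∧ G.Adj v x := by
    simp
  obtain ⟨P, h1, h2, h3, h4⟩ := aux huv (Finset.nodup_toList _) hmem
  obtain ⟨Q, k1, k2, k3, k4⟩ := aux huv.symm (Finset.nodup_toList _)
    (fun x => (hmem x).trans and_comm)
  exact ⟨_, P, Q, h1, (List.Perm.swap _ _ _).nodup_iff.1 k1, h2, k2, h3, k3, h4, k4⟩

/-- Both `v` and the entries of `P` lie in the neighbourhood of `u`, where `v` has at most one
nonneighbour. -/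
theorem length_le_one_of_degree_le_six (hrob : G.IsRobust)
    (hred : ¬ ∃ V₀ : Set V, G.IsReducible V₀) {u v : V} (hu : G.degree u ≤ 6) (huv : G.Adj u v)
    {P : List V} (hnd : (v :: P).Nodup) (hP : ∀ x ∈ P, G.Adj u x) (hPv : ∀ x ∈ P, ¬ G.Adj v x) :
    P.length ≤ 1 := by
  match P, hnd, hP, hPv with
  | [], _, _, _ => simp
  | [_], _, _, _ => simp
  | p :: q :: P, hnd, hP, hPv =>
    simp only [List.nodup_cons, List.mem_cons, not_or] at hnd
    rcases adj_or_adj_of_degree_le_six hrob hred hu huv (hP p (by simp)) (hP q (by simp))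
      hnd.1.1 hnd.1.2.1 hnd.2.1.1 with h | h
    · exact absurd h (hPv p (by simp))
    · exact absurd h (hPv q (by simp))

/-- Each of two adjacent $6^-$-vertices has at most one private neighbour, which leaves five
configurations: closed twins of degree 5 or 6, degrees 6 and 5 with four common neighbours, and
equal degrees 5 or 6 with one private neighbour each. -/
theorem not_adj_of_degree_le_six (hrob : G.IsRobust)
    (hred : ¬ ∃ V₀ : Set V, G.IsReducible V₀) {u v : V} (hu : G.degree u ≤ 6)
    (hv : G.degree v ≤ 6) : ¬ G.Adj u v := by
  have main : ∀ {u v : V}, G.degree u ≤ 6 → G.degree v ≤ G.degree u → ¬ G.Adj u v := by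
    intro u v hu hvu huv
    have hv := hvu.trans hu
    obtain ⟨A, P, Q, hndP, hndQ, hNu, hNv, hPv, hQu, hlP, hlQ⟩ := exists_common_neighbor_lists huv
    have hAu : ∀ x ∈ A, G.Adj u x := fun x hx => (hNu x).2 (by simp [hx])
    have hAv : ∀ x ∈ A, G.Adj v x := fun x hx => (hNv x).2 (by simp [hx])
    have hP1 : P.length ≤ 1 := by
      refine length_le_one_of_degree_le_six hrob hred hu huv ?_ (fun x hx => (hNu x).2 (by simp [hx]))
        hPv
      have := (List.nodup_cons.1 hndP).2
      exact this.sublist ((List.sublist_append_right A P).cons_cons v)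
    have hQ1 : Q.length ≤ 1 := by
      refine length_le_one_of_degree_le_six hrob hred hv huv.symm ?_
        (fun x hx => (hNv x).2 (by simp [hx])) hQu
      refine hndQ.sublist (List.Sublist.cons_cons u ?_)
      exact (List.sublist_append_right A Q).cons v
    -- A private neighbour `p` of `u` already has the nonneighbour `v` there, hence is adjacent to
    -- all common neighbours.
    have full : ∀ {u v p a : V}, G.degree u ≤ 6 → G.Adj u v → G.Adj u p → G.Adj u a →
        p ≠ v → p ≠ a → v ≠ a → ¬ G.Adj v p → G.Adj p a := by
      intro u v p a hu hv hp ha h1 h2 h3 hvp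
      exact (adj_or_adj_of_degree_le_six hrob hred hu hp hv ha h1 h2 h3).resolve_left
        fun h => hvp h.symm
    have du := degree_eq_five_or_six hrob hred hu
    have dv := degree_eq_five_or_six hrob hred hv
    match P, Q, hP1, hQ1 with
    | [], [], _, _ =>
      simp only [List.append_nil, List.length_nil] at *
      match A, (by omega : A.length = 4 ∨ A.length = 5) with
      | [a, b, c, d], _ =>
        exact twinsFive.contradiction hrob hred u hndP rfl
          ⟨fun x hx => (hNu x).1 hx, fun x hx => (hNv x).1 hx⟩
          ⟨fun x hx => (hNu x).2 hx, fun x hx => (hNv x).2 hx⟩ trivial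
          (missingMatching_of_degree_le_six hrob hred hu hAu) trivial twinsFive_check
      | [a, b, c, d, e], _ =>
        -- Twins subsume each other, so there is at most one nonedge among their common neighbours.
        refine twinsSix.contradiction hrob hred u hndP rfl
          ⟨fun x hx => (hNu x).1 hx, fun x hx => (hNv x).1 hx⟩
          ⟨fun x hx => (hNu x).2 hx, fun x hx => (hNv x).2 hx⟩ trivial trivial
          (atMostOneMissing_of_subsumes hrob hred (u := v) hu ?_ hAu) twinsSix_check
        rw [subsumes_iff]
        refine ⟨huv, fun w hw hwv => hAv w ?_⟩
        exact (List.mem_cons.1 ((hNu w).1 hw)).resolve_left hwv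
      | [], h | [_], h | [_, _], h | [_, _, _], h | _ :: _ :: _ :: _ :: _ :: _ :: _, h =>
        simp at h; try omega
    | [p], [], _, _ =>
      simp only [List.append_nil, List.length_nil, List.length_singleton] at *
      match A, (by omega : A.length = 4) with
      | [a, b, c, d], _ =>
        exact sixFive.contradiction hrob hred u hndP rfl
          ⟨fun x hx => (hNu x).1 hx, fun x hx => (hNv x).1 hx⟩
          ⟨fun x hx => (hNu x).2 hx, fun x hx => (hNv x).2 hx⟩ trivial
          (missingMatching_of_degree_le_six hrob hred hu hAu) trivial sixFive_check
    | [], [q], _, _ =>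
      simp only [List.length_nil, List.length_singleton] at *
      omega
    | [p], [q], _, _ =>
      simp only [List.length_singleton] at *
      have hup : G.Adj u p := (hNu p).2 (by simp)
      have hvq : G.Adj v q := (hNv q).2 (by simp)
      have hpv : ¬ G.Adj v p := hPv p (by simp)
      have hqu : ¬ G.Adj u q := hQu q (by simp)
      have hpA : ∀ a ∈ A, G.Adj p a := fun a ha =>
        full hu huv hup (hAu a ha) (by rintro rfl; simp at hndP)
          (by rintro rfl; exact hpv (hAv _ ha)) (hAv a ha).ne hpv
      have hqA : ∀ a ∈ A, G.Adj q a := fun a ha =>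
        full hv huv.symm hvq (hAv a ha) (by rintro rfl; simp at hndQ)
          (by rintro rfl; exact hqu (hAu _ ha)) (hAu a ha).ne hqu
      have hpq : p ≠ q := by rintro rfl; exact hpv hvq
      have hqP : q ∉ u :: v :: (A ++ [p]) := by
        have h1 : q ∉ A := fun h => hqu (hAu q h)
        simp [h1, hpq.symm, hvq.ne', (show q ≠ u by rintro rfl; simp at hndQ)]
      have hnd : (u :: v :: (A ++ [p, q])).Nodup := by
        have : u :: v :: (A ++ [p, q]) = (u :: v :: (A ++ [p])) ++ [q] := by simp
        rw [this]
        exact List.Nodup.append hndP (List.nodup_singleton q) (by simpa using hqP)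
      match A, (by omega : A.length = 3 ∨ A.length = 4) with
      | [a, b, c], _ =>
        -- The nonedge `vp` in the neighbourhood of the $5$-vertex `u` leaves no room for a disjoint
        -- one.
        have key : ∀ x ∈ [a, b, c], ∀ y ∈ [a, b, c], x ≠ y → G.Adj x y := by
          intro x hx y hy hxy
          refine (adj_or_adj_of_degree_eq_five hrob hred (v := u) (x := v) (y := p)
            (by simp at hlP; omega) ?_ ?_).resolve_left hpv
          · simp [huv, hup, hAu x hx, hAu y hy]
          · simp [(hAv x hx).ne, (hAv y hy).ne, (hpA x hx).ne, (hpA y hy).ne, hxy,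
              (show v ≠ p by rintro rfl; simp at hndP)]
        have hne := hnd
        simp only [List.cons_append, List.nil_append, List.nodup_cons, List.mem_cons,
          List.not_mem_nil, or_false, not_or] at hne
        refine fiveFive.contradiction hrob hred u hnd rfl
          ⟨fun x hx => (hNu x).1 hx, fun x hx => (hNv x).1 hx⟩
          ⟨fun x hx => (hNu x).2 hx, fun x hx => (hNv x).2 hx, hpA, hqA, ?_, ?_⟩ trivial
          trivial trivial fiveFive_check
        · intro x hx
          exact key a (by simp) x (List.mem_cons_of_mem _ hx)
            (by rintro rfl; exact absurd hx (by simpa using ⟨hne.2.2.1.1, hne.2.2.1.2.1⟩))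
        · intro x hx
          rw [List.mem_singleton.1 hx]
          exact key b (by simp) c (by simp) hne.2.2.2.1.1
      | [a, b, c, d], _ =>
        exact sixSix.contradiction hrob hred u hnd rfl
          ⟨fun x hx => (hNu x).1 hx, fun x hx => (hNv x).1 hx⟩
          ⟨fun x hx => (hNu x).2 hx, fun x hx => (hNv x).2 hx, hpA, hqA⟩ trivial
          (missingMatching_of_degree_le_six hrob hred hu hAu) trivial sixSix_check
      | [], h | [_], h | [_, _], h | _ :: _ :: _ :: _ :: _ :: _, h =>
        simp at h; try omega
  intro h
  rcases le_total (G.degree v) (G.degree u) with hle | hle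
  · exact main hu hle h
  · exact main hv hle h.symm

theorem not_subsumes_of_degree_eq_seven (hrob : G.IsRobust)
    (hred : ¬ ∃ V₀ : Set V, G.IsReducible V₀) {u v : V} (hu : G.degree u = 7)
    (hv : G.degree v = 6) : ¬ G.Subsumes u v := by
  intro huv
  have hsub := (subsumes_iff G u v).1 huv
  obtain ⟨A, hnd, hNv, hlen⟩ := exists_neighbor_list (G := G) v (pre := [u]) (by simp)
    (by simpa using hsub.1)
  match A, hnd, hNv, hlen with
  | [a, b, c, d, e], hnd, hNv, _ =>
    have hnd' : [v, a, b, c, d, e].Nodup := by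
      refine hnd.sublist ?_
      simp
    have hu_ne : ∀ x ∈ [a, b, c, d, e], x ≠ u := by
      rintro x hx rfl
      exact absurd hx (List.nodup_cons.1 (List.nodup_cons.1 hnd).2).1
    have hAu : ∀ x ∈ [a, b, c, d, e], G.Adj u x := fun x hx =>
      hsub.2 x ((hNv x).2 (List.mem_cons_of_mem _ hx)) (hu_ne x hx)
    obtain ⟨W, hndW, hNu, hlenW⟩ := exists_neighbor_list (G := G) u hnd' (by
      intro x hx
      rcases List.mem_cons.1 hx with rfl | hx
      · exact hsub.1.symm
      · exact hAu x hx)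
    match W, hndW, hNu, hlenW with
    | [w], hndW, hNu, _ =>
      exact sevenOverSix.contradiction hrob hred u hndW rfl
        ⟨fun x hx => (hNu x).1 hx, fun x hx => (hNv x).1 hx⟩
        ⟨fun x hx => (hNu x).2 hx, fun x hx => (hNv x).2 hx⟩ trivial trivial
        (atMostOneMissing_of_subsumes hrob hred (by omega) huv
          fun x hx => (hNv x).2 (List.mem_cons_of_mem _ hx)) sevenOverSix_check
    | [], _, _, hlen | _ :: _ :: _, _, _, hlen => simp [hu] at hlen; try omega
  | [], _, _, hlen | [_], _, _, hlen | [_, _], _, _, hlen | [_, _, _], _, _, hlen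
  | [_, _, _, _], _, _, hlen | _ :: _ :: _ :: _ :: _ :: _ :: _, _, _, hlen =>
    simp [hv] at hlen; try omega

/-- Independence of the $6^-$-vertices leaves degrees 7 and 8 for `u`, with two or three neighbours
outside the closed neighbourhood of `v`. -/
theorem not_subsumes_of_degree_le_eight (hrob : G.IsRobust)
    (hred : ¬ ∃ V₀ : Set V, G.IsReducible V₀) {u v : V} (hu : G.degree u ≤ 8)
    (hv : G.degree v = 5) : ¬ G.Subsumes u v := by
  intro huv
  have hsub := (subsumes_iff G u v).1 huv
  have hu7 : 7 ≤ G.degree u := by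
    by_contra! h
    exact not_adj_of_degree_le_six hrob hred (by omega) (by omega) hsub.1
  obtain ⟨A, hnd, hNv, hlen⟩ := exists_neighbor_list (G := G) v (pre := [u]) (by simp)
    (by simpa using hsub.1)
  match A, hnd, hNv, hlen with
  | [a, b, c, d], hnd, hNv, _ =>
    have hnd' : [v, a, b, c, d].Nodup := by
      refine hnd.sublist ?_
      simp
    have hu_ne : ∀ x ∈ [a, b, c, d], x ≠ u := by
      rintro x hx rfl
      exact absurd hx (List.nodup_cons.1 (List.nodup_cons.1 hnd).2).1
    have hAu : ∀ x ∈ [a, b, c, d], G.Adj u x := fun x hx =>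
      hsub.2 x ((hNv x).2 (List.mem_cons_of_mem _ hx)) (hu_ne x hx)
    obtain ⟨W, hndW, hNu, hlenW⟩ := exists_neighbor_list (G := G) u hnd' (by
      intro x hx
      rcases List.mem_cons.1 hx with rfl | hx
      · exact hsub.1.symm
      · exact hAu x hx)
    have hone : AtMostOneMissing G [a, b, c, d] :=
      atMostOneMissing_of_subsumes hrob hred (by omega) huv
        fun x hx => (hNv x).2 (List.mem_cons_of_mem _ hx)
    have hW : ∀ w ∈ W, ¬ G.Adj v w := by
      intro w hw h
      have hdis := (List.nodup_append'.1 (List.nodup_cons.1 hndW).2).2.2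
      have hwu : w ≠ u := by
        rintro rfl
        exact (List.nodup_cons.1 hndW).1 (List.mem_append_right _ hw)
      exact hdis (List.mem_cons_of_mem _
        ((List.mem_cons.1 ((hNv w).1 h)).resolve_left hwu)) hw
    match W, hndW, hNu, hlenW, hW with
    | [w, z], hndW, hNu, _, hW =>
      exact sevenOverFive.contradiction hrob hred u hndW rfl
        ⟨fun x hx => (hNu x).1 hx, fun x hx => (hNv x).1 hx⟩
        ⟨fun x hx => (hNu x).2 hx, fun x hx => (hNv x).2 hx⟩ hW trivial hone sevenOverFive_check
    | [w, z, y], hndW, hNu, _, hW =>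
      exact eightOverFive.contradiction hrob hred u hndW rfl
        ⟨fun x hx => (hNu x).1 hx, fun x hx => (hNv x).1 hx⟩
        ⟨fun x hx => (hNu x).2 hx, fun x hx => (hNv x).2 hx⟩ hW trivial hone eightOverFive_check
    | [], _, _, hlen, _ | [_], _, _, hlen, _ | _ :: _ :: _ :: _ :: _, _, _, hlen, _ =>
      simp at hlen; omega
  | [], _, _, hlen | [_], _, _, hlen | [_, _], _, _, hlen | [_, _, _], _, _, hlen
  | _ :: _ :: _ :: _ :: _ :: _, _, _, hlen =>
    simp [hv] at hlen; try omega

/-- The neighbourhood of `v` is an octahedron in which `u` has an antipode. The other four vertices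
form a four-cycle, and `u` has only two further neighbours. -/
theorem not_adj_of_isThin (hrob : G.IsRobust)
    (hred : ¬ ∃ V₀ : Set V, G.IsReducible V₀) {u v : V} (hu : G.degree u = 7) (hv : G.IsThin v) :
    ¬ G.Adj u v := by
  intro huv
  obtain ⟨hv6, M, -, hM⟩ := hv
  have hedge : ∀ e ∈ M.edgeSet, ∃ x y : V, G.Adj v x ∧ G.Adj v y ∧ x ≠ y ∧ ¬ G.Adj x y ∧
      Sym2.map Subtype.val e = s(x, y) := by
    intro e he
    have he' := M.edgeSet_subset he
    induction e with
    | _ x y =>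
    rw [mem_edgeSet, compl_adj] at he'
    exact ⟨x, y, x.2, y.2, fun h => he'.1 (Subtype.ext h), he'.2, rfl⟩
  have hinj : Function.Injective (Sym2.map (Subtype.val : G.neighborSet v → V)) :=
    Sym2.map.injective Subtype.val_injective
  have key := fun {a b c : V} (ha : G.Adj v a) (hb : G.Adj v b) (hc : G.Adj v c) =>
    adj_or_adj_of_degree_le_six (x := a) (y := b) (z := c) hrob hred hv6.le ha hb hc
  -- `u` has a nonneighbour among the neighbours of `v`
  obtain ⟨u', hu', huu', hnu⟩ : ∃ u', G.Adj v u' ∧ u' ≠ u ∧ ¬ G.Adj u u' := by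
    by_contra! hcon
    have hsub : G.Subsumes u v := (subsumes_iff G u v).2 ⟨huv.symm, hcon⟩
    obtain ⟨e, he, f, hf, hef⟩ := (Set.one_lt_ncard (Set.finite_of_ncard_ne_zero (by omega))).1
      (by omega : 1 < M.edgeSet.ncard)
    obtain ⟨x, y, hx, hy, hxy, nxy, heq⟩ := hedge e he
    obtain ⟨z, w, hz, hw, hzw, nzw, hfq⟩ := hedge f hf
    have := atMostOneMissing_of_subsumes hrob hred hv6.le hsub (l := [x, y, z, w])
      (by simp [hx, hy, hz, hw]) x (by simp) y (by simp) z (by simp) w (by simp) hxy hzw nxy nzw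
    exact hef (hinj (by rw [heq, hfq, this]))
  -- The matching supplies a nonedge other than `uu'`, and it is disjoint from `uu'` because
  -- nonedges form a matching.
  obtain ⟨a, b, ha, hb, hab, nab, hne⟩ : ∃ a b, G.Adj v a ∧ G.Adj v b ∧ a ≠ b ∧ ¬ G.Adj a b ∧
      s(a, b) ≠ s(u, u') := by
    by_contra! hcon
    obtain ⟨e, he, f, hf, hef⟩ := (Set.one_lt_ncard (Set.finite_of_ncard_ne_zero (by omega))).1
      (by omega : 1 < M.edgeSet.ncard)
    obtain ⟨x, y, hx, hy, hxy, nxy, heq⟩ := hedge e he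
    obtain ⟨z, w, hz, hw, hzw, nzw, hfq⟩ := hedge f hf
    exact hef (hinj (by rw [heq, hfq, hcon x y hx hy hxy nxy, hcon z w hz hw hzw nzw]))
  have hvu := huv.symm
  have fullu : ∀ x, G.Adj v x → x ≠ u → x ≠ u' → G.Adj u x := fun x hx h1 h2 =>
    (key hvu hu' hx huu'.symm h1.symm h2.symm).resolve_left hnu
  have fullu' : ∀ x, G.Adj v x → x ≠ u → x ≠ u' → G.Adj u' x := fun x hx h1 h2 =>
    (key hu' hvu hx huu' h2.symm h1.symm).resolve_left fun h => hnu h.symm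
  have hau : a ≠ u := by
    rintro rfl
    exact nab (fullu b hb hab.symm fun h => hne (by rw [h]))
  have hau' : a ≠ u' := by
    rintro rfl
    exact nab (fullu' b hb (fun h => hne (by rw [h, Sym2.eq_swap])) hab.symm)
  have hbu : b ≠ u := by
    rintro rfl
    exact nab (fullu a ha hau hau').symm
  have hbu' : b ≠ u' := by
    rintro rfl
    exact nab (fullu' a ha hau hau').symm
  obtain ⟨p, q, hnd, hNv, npq⟩ := exists_nonedge_of_degree_eq_six hrob hred hv6
    (x := u) (y := u') (z := a) (w := b) (by simp [hvu, hu', ha, hb])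
    (by simp [huu'.symm, hau.symm, hau'.symm, hbu.symm, hbu'.symm, hab]) hnu nab
  have hp : G.Adj v p := (hNv p).2 (by simp)
  have hq : G.Adj v q := (hNv q).2 (by simp)
  simp only [List.nodup_cons, List.mem_cons, List.not_mem_nil, or_false, not_or] at hnd
  obtain ⟨hv', ⟨-, -, -, hup, huq⟩, ⟨-, -, hu'p, hu'q⟩, ⟨-, hap, haq⟩, ⟨hbp, hbq⟩, hpq, -⟩ := hnd
  obtain ⟨W, hndW, hNu, hlenW⟩ := exists_neighbor_list (G := G) u (pre := [v, a, b, p, q])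
    (by simp [hv', hab, hap, haq, hbp, hbq, hpq])
    (by
      simp [huv, fullu a ha hau hau', fullu b hb hbu hbu', fullu p hp (Ne.symm hup) (Ne.symm hu'p),
        fullu q hq (Ne.symm huq) (Ne.symm hu'q)])
  match W, hndW, hNu, hlenW with
  | [w, z], hndW, hNu, _ =>
    have hu'w : u' ≠ w := by
      rintro rfl
      exact hnu ((hNu _).2 (by simp))
    have hu'z : u' ≠ z := by
      rintro rfl
      exact hnu ((hNu _).2 (by simp))
    have hnd : [u, v, a, b, p, q, u', w, z].Nodup := by
      have h1 : (u :: [v, a, b, p, q] ++ u' :: [w, z]).Nodup := by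
        rw [List.nodup_middle]
        refine List.nodup_cons.2 ⟨?_, hndW⟩
        simp [huu', hu'w, hu'z, hau'.symm, hbu'.symm, hu'p, hu'q, hu'.ne']
      exact h1
    have hperm : [u, u', a, b, p, q].Perm [u, a, b, p, q, u'] :=
      (List.perm_append_singleton u' [a, b, p, q]).symm.cons u
    refine sevenThin.contradiction hrob hred u hnd rfl
      ⟨fun x hx => (hNu x).1 hx, fun x hx => ?_⟩
      ⟨fun x hx => (hNu x).2 hx, fun x hx => (hNv x).2 ?_, ?_, ?_⟩
      ⟨fun x hx => List.mem_singleton.1 hx ▸ nab, fun x hx => List.mem_singleton.1 hx ▸ npq⟩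
      trivial trivial sevenThin_check
    · exact hperm.mem_iff.1 ((hNv x).1 hx)
    · exact hperm.mem_iff.2 hx
    · change ∀ x ∈ [p, q], G.Adj a x
      simp only [List.mem_cons, List.not_mem_nil, or_false, forall_eq_or_imp, forall_eq]
      exact ⟨(key ha hb hp hab hap hbp).resolve_left nab, (key ha hb hq hab haq hbq).resolve_left nab⟩
    · change ∀ x ∈ [p, q], G.Adj b x
      have nba : ¬ G.Adj b a := fun h => nab h.symm
      simp only [List.mem_cons, List.not_mem_nil, or_false, forall_eq_or_imp, forall_eq]
      exact ⟨(key hb ha hp hab.symm hbp hap).resolve_left nba,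
        (key hb ha hq hab.symm hbq haq).resolve_left nba⟩
  | [], _, _, hlen | [_], _, _, hlen | _ :: _ :: _ :: _, _, _, hlen => simp [hu] at hlen; try omega

end
end SimpleGraph

namespace SimpleGraph

/-! ### Matchings between neighbours of a vertex -/

section

variable {V : Type*} [DecidableEq V] {G : SimpleGraph V}

/-- A vertex `v` is reducible if the edges between its neighbours are covered by a matching `g` of
`D` and a set `Q` of at most `|D|` vertices. -/
theorem isReducible_of_matching {v : V} {D Q : Finset V} {g : V → V}
    (hD : ∀ c ∈ D, G.Adj v c ∧ G.Adj v (g c) ∧ G.Adj c (g c)) (hinj : Set.InjOn g D)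
    (hg : ∀ c ∈ D, g c ∉ D) (hQ : ∀ q ∈ Q, G.Adj v q) (hcard : Q.card ≤ D.card)
    (hcov : ∀ x y, G.Adj v x → G.Adj v y → G.Adj x y →
      x ∈ Q ∨ y ∈ Q ∨ (x ∈ D ∧ y = g x) ∨ (y ∈ D ∧ x = g y)) : G.IsReducible {v} := by
  have hinter : ∀ c ∈ D, ∀ c' ∈ D, c ≠ c' → ∀ x ∈ ({v, c, g c} : Finset V),
      x ∈ ({v, c', g c'} : Finset V) → x = v := by
    intro c hc c' hc' hne x hx hx'
    simp only [Finset.mem_insert, Finset.mem_singleton] at hx hx'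
    rcases hx with rfl | rfl | rfl
    · rfl
    · rcases hx' with h | h | h
      · exact h
      · exact absurd h hne
      · exact absurd (h ▸ hc) (hg c' hc')
    · rcases hx' with h | h | h
      · exact h
      · exact absurd (h ▸ hc') (hg c hc)
      · exact absurd (hinj hc hc' h) hne
  have hS : (D.image fun c => ({v, c, g c} : Finset V)).card = D.card := by
    refine Finset.card_image_of_injOn fun c hc c' hc' h => ?_
    by_contra hne
    have h' : ({v, c, g c} : Finset V) = {v, c', g c'} := h
    exact (hD c hc).1.ne' (hinter c hc c' hc' hne c (by simp) (h' ▸ by simp))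
  refine ⟨D.image fun c => {v, c, g c}, (D.image fun c => s(c, g c)) ∪ Q.image fun q => s(v, q),
    Set.singleton_nonempty v, ?_, ?_, ?_, ?_, ?_, ?_⟩
  · simp only [Finset.mem_image, forall_exists_index, and_imp, forall_apply_eq_imp_iff₂]
    exact fun c hc => is3Clique_triple_iff.2 (hD c hc)
  · simp only [Finset.mem_image, forall_exists_index, and_imp, forall_apply_eq_imp_iff₂]
    intro c hc c' hc' hne
    rw [Set.disjoint_left]
    intro e he he'
    induction e with
    | _ x y =>
    have hcc : c ≠ c' := fun h => hne (by rw [h])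
    have hx := hinter c hc c' hc' hcc x (he.2 x (Sym2.mem_mk_left x y))
      (he'.2 x (Sym2.mem_mk_left x y))
    have hy := hinter c hc c' hc' hcc y (he.2 y (Sym2.mem_mk_right x y))
      (he'.2 y (Sym2.mem_mk_right x y))
    exact he.1 (Sym2.mk_isDiag_iff.2 (hx.trans hy.symm))
  · intro e he
    simp only [Finset.coe_union, Finset.coe_image, Set.mem_union, Set.mem_image] at he
    rcases he with ⟨c, hc, rfl⟩ | ⟨q, hq, rfl⟩
    · exact (hD c hc).2.2
    · exact hQ q hq
  · rw [hS]
    have h1 := Finset.card_union_le (D.image fun c => s(c, g c)) (Q.image fun q => s(v, q))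
    have h2 := Finset.card_image_le (s := D) (f := fun c => s(c, g c))
    have h3 := Finset.card_image_le (s := Q) (f := fun q => s(v, q))
    omega
  · intro T hT w hw hwT
    rw [Set.mem_singleton_iff] at hw
    subst hw
    obtain ⟨x, y, hxy, hT'⟩ := Finset.card_eq_two.1
      (by rw [Finset.card_erase_of_mem hwT, hT.2] : (T.erase w).card = 2)
    have hx : x ≠ w ∧ x ∈ T := Finset.mem_erase.1 (hT' ▸ by simp)
    have hy : y ≠ w ∧ y ∈ T := Finset.mem_erase.1 (hT' ▸ by simp)
    have hwx := hT.1 hwT hx.2 hx.1.symm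
    have hwy := hT.1 hwT hy.2 hy.1.symm
    have hxy := hT.1 hx.2 hy.2 hxy
    simp only [deleteEdges_adj, Finset.coe_union, Finset.coe_image, Set.mem_union,
      Set.mem_image, not_or, not_exists, not_and, Finset.mem_coe] at hwx hwy hxy
    rcases hcov x y hwx.1 hwy.1 hxy.1 with h | h | ⟨h, rfl⟩ | ⟨h, rfl⟩
    · exact hwx.2.2 x h rfl
    · exact hwy.2.2 y h rfl
    · exact hxy.2.1 x h rfl
    · exact hxy.2.1 y h Sym2.eq_swap
  · simp only [Finset.mem_image, forall_exists_index, and_imp, forall_apply_eq_imp_iff₂]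
    intro c hc e he hout
    induction e with
    | _ x y =>
    have hx := he.2 x (Sym2.mem_mk_left x y)
    have hy := he.2 y (Sym2.mem_mk_right x y)
    have hxv : x ≠ v := hout x (Sym2.mem_mk_left x y)
    have hyv : y ≠ v := hout y (Sym2.mem_mk_right x y)
    have hxy : x ≠ y := fun h => he.1 (Sym2.mk_isDiag_iff.2 h)
    simp only [Finset.mem_insert, Finset.mem_singleton, hxv, hyv, false_or] at hx hy
    refine Finset.mem_union_left _ (Finset.mem_image.2 ⟨c, hc, ?_⟩)
    rcases hx with rfl | rfl <;> rcases hy with rfl | rfl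
    · exact absurd rfl hxy
    · rfl
    · exact Sym2.eq_swap
    · exact absurd rfl hxy

/-- Hall's theorem, with the matching given as a function on all vertices. -/
theorem exists_matching_of_card_le [DecidableRel G.Adj] {B D : Finset V}
    (h : ∀ S ⊆ D, S.card ≤ (B.filter fun b => ∃ c ∈ S, G.Adj c b).card) :
    ∃ g : V → V, Set.InjOn g D ∧ ∀ c ∈ D, g c ∈ B ∧ G.Adj c (g c) := by
  obtain ⟨f, hf, hmem⟩ := (Finset.all_card_le_biUnion_card_iff_exists_injective
    fun c : D => B.filter fun b => G.Adj c b).1 (by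
      intro S
      have := h (S.map (Function.Embedding.subtype _)) (by
        intro x hx
        obtain ⟨y, -, rfl⟩ := Finset.mem_map.1 hx
        exact y.2)
      rw [Finset.card_map] at this
      refine this.trans (Finset.card_le_card fun b hb => ?_)
      obtain ⟨hb, c, hc, hcb⟩ := Finset.mem_filter.1 hb
      obtain ⟨y, hy, rfl⟩ := Finset.mem_map.1 hc
      exact Finset.mem_biUnion.2 ⟨y, hy, Finset.mem_filter.2 ⟨hb, hcb⟩⟩)
  refine ⟨fun c => if hc : c ∈ D then f ⟨c, hc⟩ else c, ?_, ?_⟩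
  · intro c hc c' hc' hcc
    rw [Finset.mem_coe] at hc hc'
    simp only [hc, hc', dif_pos] at hcc
    exact congrArg Subtype.val (hf hcc)
  · intro c hc
    simp only [hc, dif_pos]
    exact Finset.mem_filter.1 (hmem ⟨c, hc⟩)

end

theorem card_add_card_le {V : Type*} {G : SimpleGraph V} [DecidableRel G.Adj] {C S : Finset V} {b : V} (hS : S ⊆ C) (h : ∀ c ∈ S, ¬ G.Adj c b) :
    S.card + (C.filter fun c => G.Adj c b).card ≤ C.card := by
  rw [← Finset.card_filter_add_card_filter_not (s := C) fun c => G.Adj c b, add_comm]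
  exact Nat.add_le_add_left (Finset.card_le_card fun c hc =>
    Finset.mem_filter.2 ⟨hS hc, h c hc⟩) _

/-! ### Low and high neighbours of a vertex -/

section

variable {V : Type*} [Fintype V] (G : SimpleGraph V) [DecidableRel G.Adj]

/-- The neighbours of `v` that are `6⁻`-vertices. -/
def lowNeighbors (v : V) : Finset V := (G.neighborFinset v).filter fun w => G.degree w ≤ 6

/-- The neighbours of `v` that are `7⁺`-vertices. -/
def highNeighbors (v : V) : Finset V := (G.neighborFinset v).filter fun w => ¬ G.degree w ≤ 6

variable {G}

theorem mem_lowNeighbors {v w : V} : w ∈ G.lowNeighbors v ↔ G.Adj v w ∧ G.degree w ≤ 6 := by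
  rw [lowNeighbors, Finset.mem_filter, mem_neighborFinset]

theorem mem_highNeighbors {v w : V} : w ∈ G.highNeighbors v ↔ G.Adj v w ∧ ¬ G.degree w ≤ 6 := by
  rw [highNeighbors, Finset.mem_filter, mem_neighborFinset]

theorem card_lowNeighbors_add_card_highNeighbors (v : V) :
    (G.lowNeighbors v).card + (G.highNeighbors v).card = G.degree v := by
  rw [lowNeighbors, highNeighbors, Finset.card_filter_add_card_filter_not,
    card_neighborFinset_eq_degree]

end

section

variable {V : Type*} [Fintype V] [DecidableEq V] {G : SimpleGraph V} [DecidableRel G.Adj]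

/-- The neighbours of `b` are `v`, at most one vertex not adjacent to `v` (none if `v` subsumes
`b`), and common neighbours with `v`, which are high because low vertices are independent. -/
theorem degree_le_card_add_two (hrob : G.IsRobust) (hred : ¬ ∃ V₀ : Set V, G.IsReducible V₀)
    {v b : V} (hb : b ∈ G.lowNeighbors v) :
    G.degree b ≤ ((G.highNeighbors v).filter fun c => G.Adj c b).card + 2 ∧
      (G.Subsumes v b → G.degree b ≤ ((G.highNeighbors v).filter fun c => G.Adj c b).card + 1) := by
  obtain ⟨hvb, hb6⟩ := mem_lowNeighbors.1 hb
  obtain ⟨A, P, Q, hndP, -, hNb, hNv, hPv, -, hlP, -⟩ := exists_common_neighbor_lists hvb.symm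
  have hP1 : P.length ≤ 1 := by
    refine length_le_one_of_degree_le_six hrob hred hb6 hvb.symm ?_
      (fun x hx => (hNb x).2 (by simp [hx])) hPv
    exact (List.nodup_cons.1 hndP).2.sublist ((List.sublist_append_right A P).cons_cons v)
  have hA : A.length ≤ ((G.highNeighbors v).filter fun c => G.Adj c b).card := by
    have hndA : A.Nodup := hndP.sublist (((List.sublist_append_left A P).cons v).cons b)
    rw [← List.toFinset_card_of_nodup hndA]
    refine Finset.card_le_card fun x hx => ?_
    rw [List.mem_toFinset] at hx
    have hbx : G.Adj b x := (hNb x).2 (by simp [hx])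
    refine Finset.mem_filter.2 ⟨mem_highNeighbors.2 ⟨(hNv x).2 (by simp [hx]), fun h => ?_⟩,
      hbx.symm⟩
    exact not_adj_of_degree_le_six hrob hred hb6 h hbx
  refine ⟨by omega, fun hsub => ?_⟩
  rw [subsumes_iff] at hsub
  have : P = [] := by
    refine List.eq_nil_iff_forall_not_mem.2 fun x hx => hPv x hx (hsub.2 x
      ((hNb x).2 (by simp [hx])) ?_)
    rintro rfl
    simp [hx] at hndP
  simp only [this, List.length_nil] at hlP
  omega

/-- The `7⁺`-neighbours `D` of `v` cannot be matched to `6⁻`-neighbours if at most one `7⁺`-neighbour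
is missing from `Q`, and it is in `D` and has just one neighbour among the `6⁻`-neighbours, if any. -/
theorem false_of_matching (hrob : G.IsRobust) (hred : ¬ ∃ V₀ : Set V, G.IsReducible V₀) {v : V}
    {D Q : Finset V} (hD : D ⊆ G.highNeighbors v) (hQ : Q ⊆ G.highNeighbors v)
    (hcard : Q.card ≤ D.card)
    (hall : ∀ S ⊆ D, S.card ≤ ((G.lowNeighbors v).filter fun b => ∃ c ∈ S, G.Adj c b).card)
    (hsub : ∀ c ∈ G.highNeighbors v, ∀ c' ∈ G.highNeighbors v, c ∉ Q → c' ∉ Q → c = c')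
    (hlow : ∀ c ∈ G.highNeighbors v, c ∉ Q → ∀ b ∈ G.lowNeighbors v, G.Adj c b →
      c ∈ D ∧ ∀ b' ∈ G.lowNeighbors v, G.Adj c b' → b = b') : False := by
  obtain ⟨g, hinj, hg⟩ := exists_matching_of_card_le hall
  refine hred ⟨{v}, isReducible_of_matching (D := D) (Q := Q) (g := g) ?_ hinj ?_ ?_ hcard ?_⟩
  · exact fun c hc => ⟨(mem_highNeighbors.1 (hD hc)).1, (mem_lowNeighbors.1 (hg c hc).1).1,
      (hg c hc).2⟩
  · exact fun c hc h => (mem_highNeighbors.1 (hD h)).2 (mem_lowNeighbors.1 (hg c hc).1).2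
  · exact fun q hq => (mem_highNeighbors.1 (hQ hq)).1
  · intro x y hx hy hxy
    by_contra! hcon
    obtain ⟨hxQ, hyQ, h1, h2⟩ := hcon
    by_cases hx6 : G.degree x ≤ 6 <;> by_cases hy6 : G.degree y ≤ 6
    · exact not_adj_of_degree_le_six hrob hred hx6 hy6 hxy
    · have hmem := mem_lowNeighbors.2 ⟨hx, hx6⟩
      obtain ⟨hyD, huniq⟩ := hlow y (mem_highNeighbors.2 ⟨hy, hy6⟩) hyQ x hmem hxy.symm
      exact h2 hyD (huniq _ (hg y hyD).1 (hg y hyD).2)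
    · have hmem := mem_lowNeighbors.2 ⟨hy, hy6⟩
      obtain ⟨hxD, huniq⟩ := hlow x (mem_highNeighbors.2 ⟨hx, hx6⟩) hxQ y hmem hxy
      exact h1 hxD (huniq _ (hg x hxD).1 (hg x hxD).2)
    · exact hxy.ne (hsub x (mem_highNeighbors.2 ⟨hx, hx6⟩) y (mem_highNeighbors.2 ⟨hy, hy6⟩)
        hxQ hyQ)

/-- Otherwise there are at most three high neighbours and at least four low ones. Every low
neighbour is adjacent to three high ones, hence to all, and Hall's condition is immediate. -/
theorem card_lowNeighbors_le (hrob : G.IsRobust)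
    (hred : ¬ ∃ V₀ : Set V, G.IsReducible V₀) {v : V} (h7 : 7 ≤ G.degree v) :
    (G.lowNeighbors v).card ≤ G.degree v - 4 := by
  by_contra! hcon
  have hsum := card_lowNeighbors_add_card_highNeighbors (G := G) v
  have key : ∀ b ∈ G.lowNeighbors v, 3 ≤ ((G.highNeighbors v).filter fun c => G.Adj c b).card := by
    intro b hb
    have h1 := (degree_le_card_add_two hrob hred hb).1
    have h2 := degree_eq_five_or_six hrob hred (mem_lowNeighbors.1 hb).2
    omega
  refine false_of_matching hrob hred (v := v) (D := G.highNeighbors v) (Q := G.highNeighbors v)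
    subset_rfl subset_rfl le_rfl ?_ (fun c hc _ _ h => absurd hc h) (fun c hc h => absurd hc h)
  intro S hS
  rcases S.eq_empty_or_nonempty with rfl | ⟨c, hc⟩
  · simp
  rw [Finset.filter_true_of_mem]
  · have := Finset.card_le_card hS
    omega
  · intro b hb
    refine ⟨c, hc, ?_⟩
    by_contra h
    have h1 := card_add_card_le (G := G) (b := b) (Finset.singleton_subset_iff.2 (hS hc))
      (by simpa using h)
    have h2 := key b hb
    rw [Finset.card_singleton] at h1
    omega

/-- A vertex with at least five `6⁻`-neighbours and at most five `7⁺`-neighbours subsumes no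
`6⁻`-vertex. -/
theorem not_subsumes_of_card_highNeighbors_le_five (hrob : G.IsRobust)
    (hred : ¬ ∃ V₀ : Set V, G.IsReducible V₀) {v w : V} (hw : w ∈ G.lowNeighbors v)
    (hB : 5 ≤ (G.lowNeighbors v).card) (hC : (G.highNeighbors v).card ≤ 5) :
    ¬ G.Subsumes v w := by
  intro hvw
  -- A low neighbour misses at most two of the at most five high ones, and the subsumed `w` at most
  -- one. So Hall's condition can fail only for sets of size one or two.
  have key : ∀ b ∈ G.lowNeighbors v, ∀ S ⊆ G.highNeighbors v, (∀ c ∈ S, ¬ G.Adj c b) →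
      S.card ≤ 2 := by
    intro b hb S hS h
    have h1 := (degree_le_card_add_two hrob hred hb).1
    have h2 := degree_eq_five_or_six hrob hred (mem_lowNeighbors.1 hb).2
    have h3 := card_add_card_le hS h
    omega
  have keyw : ∀ S ⊆ G.highNeighbors v, (∀ c ∈ S, ¬ G.Adj c w) → S.card ≤ 1 := by
    intro S hS h
    have h1 := (degree_le_card_add_two hrob hred hw).2 hvw
    have h2 := degree_eq_five_or_six hrob hred (mem_lowNeighbors.1 hw).2
    have h3 := card_add_card_le hS h
    omega
  have three : ∀ S ⊆ G.highNeighbors v, 3 ≤ S.card →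
      S.card ≤ ((G.lowNeighbors v).filter fun b => ∃ c ∈ S, G.Adj c b).card := by
    intro S hS h3
    rw [Finset.filter_true_of_mem]
    · have := Finset.card_le_card hS
      omega
    · intro b hb
      by_contra! hcon
      have := key b hb S hS hcon
      omega
  -- A high neighbour without low neighbours can be left out: at most one high vertex outside `Q`
  -- leaves no uncovered edge. Then `w` has used up its only miss, and every other low vertex one of
  -- its two.
  by_cases h0 : ∃ c₀ ∈ G.highNeighbors v, ∀ b ∈ G.lowNeighbors v, ¬ G.Adj c₀ b
  · obtain ⟨c₀, hc₀, h0⟩ := h0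
    refine false_of_matching hrob hred (v := v) (D := (G.highNeighbors v).erase c₀)
      (Q := (G.highNeighbors v).erase c₀) (Finset.erase_subset _ _) (Finset.erase_subset _ _)
      le_rfl ?_ ?_ ?_
    · intro S hS
      have hS' := Finset.insert_subset hc₀ (hS.trans (Finset.erase_subset _ _))
      have hcS : c₀ ∉ S := fun h => (Finset.mem_erase.1 (hS h)).1 rfl
      have hcard := Finset.card_le_card hS'
      rw [Finset.card_insert_of_notMem hcS] at hcard
      rcases Nat.lt_or_ge S.card 2 with h2 | h2
      · rcases S.eq_empty_or_nonempty with rfl | ⟨c, hc⟩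
        · simp
        have hpos : 0 < ((G.lowNeighbors v).filter fun b => ∃ c ∈ S, G.Adj c b).card := by
          refine Finset.card_pos.2 ⟨w, Finset.mem_filter.2 ⟨hw, c, hc, ?_⟩⟩
          by_contra hcw
          have := keyw {c₀, c} (Finset.insert_subset hc₀ (Finset.singleton_subset_iff.2
            (hS' (Finset.mem_insert_of_mem hc)))) (by simp [hcw, h0 w hw])
          rw [Finset.card_pair (by rintro rfl; exact hcS hc)] at this
          omega
        omega
      · rw [Finset.filter_true_of_mem]
        · omega
        · intro b hb
          by_contra! hcon
          have := key b hb _ hS' (by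
            intro c hc
            rcases Finset.mem_insert.1 hc with rfl | hc
            · exact h0 b hb
            · exact hcon c hc)
          rw [Finset.card_insert_of_notMem hcS] at this
          omega
    · intro c hc c' hc' h h'
      simp only [Finset.mem_erase, hc, hc', and_true, not_not] at h h'
      rw [h, h']
    · intro c hc h b hb hcb
      simp only [Finset.mem_erase, hc, and_true, not_not] at h
      exact absurd (h ▸ hcb) (h0 b hb)
  push Not at h0
  have one : ∀ S ⊆ G.highNeighbors v, S.card ≤ 1 →
      S.card ≤ ((G.lowNeighbors v).filter fun b => ∃ c ∈ S, G.Adj c b).card := by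
    intro S hS h1
    rcases S.eq_empty_or_nonempty with rfl | ⟨c, hc⟩
    · simp
    obtain ⟨b, hb, hcb⟩ := h0 c (hS hc)
    refine h1.trans (Finset.card_pos.2 ⟨b, Finset.mem_filter.2 ⟨hb, c, hc, hcb⟩⟩)
  by_cases htwo : ∀ S ⊆ G.highNeighbors v, S.card = 2 →
      S.card ≤ ((G.lowNeighbors v).filter fun b => ∃ c ∈ S, G.Adj c b).card
  · refine false_of_matching hrob hred (v := v) (D := G.highNeighbors v) (Q := G.highNeighbors v)
      subset_rfl subset_rfl le_rfl ?_ (fun c hc _ _ h => absurd hc h) (fun c hc h => absurd hc h)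
    intro S hS
    rcases (by omega : S.card ≤ 1 ∨ S.card = 2 ∨ 3 ≤ S.card) with h | h | h
    exacts [one S hS h, htwo S hS h, three S hS h]
  · push Not at htwo
    obtain ⟨S, hS, hS2, hlt⟩ := htwo
    obtain ⟨c₁, c₂, hne, rfl⟩ := Finset.card_eq_two.1 hS2
    rw [hS2] at hlt
    have huniq : ∀ b ∈ G.lowNeighbors v, ∀ b' ∈ G.lowNeighbors v, (∃ c ∈ ({c₁, c₂} : Finset V),
        G.Adj c b) → (∃ c ∈ ({c₁, c₂} : Finset V), G.Adj c b') → b = b' := by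
      intro b hb b' hb' h h'
      exact Finset.card_le_one.1 (Nat.le_of_lt_succ hlt) b (Finset.mem_filter.2 ⟨hb, h⟩) b'
        (Finset.mem_filter.2 ⟨hb', h'⟩)
    have hc₁ : c₁ ∈ G.highNeighbors v := hS (by simp)
    have hc₂ : c₂ ∈ G.highNeighbors v := hS (by simp)
    -- Since `c₁` and `c₂` together have at most one low neighbour, `c₁` may be omitted from `Q`:
    -- its only edge to a low vertex is its matching edge.
    refine false_of_matching hrob hred (v := v) (D := (G.highNeighbors v).erase c₂)
      (Q := (G.highNeighbors v).erase c₁) (Finset.erase_subset _ _) (Finset.erase_subset _ _)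
      (by rw [Finset.card_erase_of_mem hc₁, Finset.card_erase_of_mem hc₂]) ?_ ?_ ?_
    · intro T hT
      have hT' := hT.trans (Finset.erase_subset _ _)
      rcases Nat.lt_or_ge 1 T.card with h2 | h2
      · obtain ⟨y, hy, hyc⟩ := Finset.exists_mem_ne h2 c₁
        have hyc₂ : y ≠ c₂ := (Finset.mem_erase.1 (hT hy)).1
        -- All low vertices except at most one miss both `c₁` and `c₂`, hence are adjacent to `y`;
        -- this gives at least four, and `T` has at most four elements.
        have hle : ((G.lowNeighbors v) \ (G.lowNeighbors v).filter fun b =>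
            ∃ c ∈ ({c₁, c₂} : Finset V), G.Adj c b).card ≤
            ((G.lowNeighbors v).filter fun b => ∃ c ∈ T, G.Adj c b).card := by
          refine Finset.card_le_card fun b hb => ?_
          obtain ⟨hb, hb'⟩ := Finset.mem_sdiff.1 hb
          refine Finset.mem_filter.2 ⟨hb, y, hy, ?_⟩
          by_contra hyb
          have := key b hb {y, c₁, c₂} (Finset.insert_subset (hT' hy) hS) (by
            intro c hc
            rcases Finset.mem_insert.1 hc with rfl | hc
            · exact hyb
            · exact fun h => hb' (Finset.mem_filter.2 ⟨hb, c, hc, h⟩))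
          rw [Finset.card_eq_three.2 ⟨y, c₁, c₂, hyc, hyc₂, hne, rfl⟩] at this
          omega
        rw [Finset.card_sdiff_of_subset (Finset.filter_subset _ _)] at hle
        have := Finset.card_le_card hT
        rw [Finset.card_erase_of_mem hc₂] at this
        omega
      · exact one T hT' h2
    · intro c hc c' hc' h h'
      simp only [Finset.mem_erase, hc, hc', and_true, not_not] at h h'
      rw [h, h']
    · intro c hc h b hb hcb
      simp only [Finset.mem_erase, hc, and_true, not_not] at h
      subst h
      refine ⟨Finset.mem_erase.2 ⟨hne, hc₁⟩, fun b' hb' hcb' => ?_⟩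
      exact huniq b hb b' hb' ⟨c, by simp, hcb⟩ ⟨c, by simp, hcb'⟩

end
end SimpleGraph

namespace SimpleGraph

/-! ### Vertices of degree nine -/

section

variable {V : Type*} [Fintype V] [DecidableEq V] {G : SimpleGraph V} [DecidableRel G.Adj]

/-- A subsumed low neighbour is adjacent to at least four of the five high ones. The exceptional `c`
need not be a nonneighbour. -/
theorem exists_forall_adj_of_subsumes (hrob : G.IsRobust)
    (hred : ¬ ∃ V₀ : Set V, G.IsReducible V₀) {v b : V} (hb : b ∈ G.lowNeighbors v)
    (hvb : G.Subsumes v b) (hC : (G.highNeighbors v).card = 5) :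
    ∃ c ∈ G.highNeighbors v, ∀ x ∈ G.highNeighbors v, x ≠ c → G.Adj b x := by
  have h1 := (degree_le_card_add_two hrob hred hb).2 hvb
  have h2 := degree_eq_five_or_six hrob hred (mem_lowNeighbors.1 hb).2
  by_contra! hcon
  obtain ⟨c₀, hc₀⟩ := Finset.card_pos.1 (by omega : 0 < (G.highNeighbors v).card)
  obtain ⟨c, hc, -, hbc⟩ := hcon c₀ hc₀
  obtain ⟨d, hd, hdc, hbd⟩ := hcon c hc
  have h3 := card_add_card_le (G := G) (b := b) (Finset.insert_subset hc
    (Finset.singleton_subset_iff.2 hd)) (by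
      intro x hx
      rcases Finset.mem_insert.1 hx with rfl | hx
      · exact fun h => hbc h.symm
      · rw [Finset.mem_singleton.1 hx]
        exact fun h => hbd h.symm)
  rw [Finset.card_pair hdc.symm] at h3
  omega

/-- A vertex with exactly four `6⁻`-neighbours and five `7⁺`-neighbours does not subsume three
`6⁻`-vertices. -/
theorem not_subsumes_three (hrob : G.IsRobust)
    (hred : ¬ ∃ V₀ : Set V, G.IsReducible V₀) {v a b c d : V}
    (hB : (G.lowNeighbors v) = {a, b, c, d}) (hC : (G.highNeighbors v).card = 5)
    (hnd : [a, b, c, d].Nodup) (ha : G.Subsumes v a) (hb : G.Subsumes v b)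
    (hc : G.Subsumes v c) : False := by
  have hmem : ∀ x, x ∈ G.lowNeighbors v ↔ x ∈ [a, b, c, d] := by simp [hB]
  have hmiss := fun x (hx : x ∈ [a, b, c, d]) hv =>
    exists_forall_adj_of_subsumes (b := x) hrob hred ((hmem x).2 hx) hv hC
  obtain ⟨p, hp, hap⟩ := hmiss a (by simp) ha
  obtain ⟨q, hq, hbq⟩ := hmiss b (by simp) hb
  obtain ⟨r, hr, hcr⟩ := hmiss c (by simp) hc
  have hone := fun {x y : V} (hx : x ∈ [a, b, c, d]) (hv : G.Subsumes v x)
      (hxy : ∀ z ∈ G.highNeighbors v, z ≠ y → G.Adj x z) (l : List V)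
      (hl : ∀ z ∈ l, z ∈ G.highNeighbors v ∧ z ≠ y) =>
    atMostOneMissing_of_subsumes hrob hred (mem_lowNeighbors.1 ((hmem x).2 hx)).2 hv (l := l)
      fun z hz => hxy z (hl z hz).1 (hl z hz).2
  have setup : ∀ {x y z : V} {l : List V}, [x, y, z, d].Perm [a, b, c, d] →
      l.Nodup → (∀ t, t ∈ G.highNeighbors v ↔ t ∈ l) →
      ([v, x, y, z] ++ l ++ [d]).Nodup ∧ ∀ t, G.Adj v t ↔ t ∈ [x, y, z] ++ l ++ [d] := by
    intro x y z l hperm hl hlC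
    have hp1 : ([x, y, z] ++ l ++ [d]).Perm ([a, b, c, d] ++ l) := by
      refine List.Perm.trans ?_ (hperm.append_right l)
      rw [List.append_assoc, show [x, y, z, d] = [x, y, z] ++ [d] from rfl, List.append_assoc]
      exact List.perm_append_comm.append_left [x, y, z]
    have hadj : ∀ t, G.Adj v t ↔ t ∈ [x, y, z] ++ l ++ [d] := by
      intro t
      rw [hp1.mem_iff, List.mem_append, ← hmem, ← hlC, mem_lowNeighbors, mem_highNeighbors]
      tauto
    refine ⟨List.nodup_cons.2 ⟨fun h => G.irrefl ((hadj v).2 h), ?_⟩, hadj⟩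
    refine hp1.nodup_iff.2 (List.Nodup.append hnd hl fun t ht ht' => ?_)
    exact (mem_highNeighbors.1 ((hlC t).2 ht')).2 (mem_lowNeighbors.1 ((hmem t).2 ht)).2
  have hub : ∀ {x : V}, x ∈ [a, b, c, d] → G.Subsumes v x → ∀ {l : List V},
      (∀ t, t ∈ G.highNeighbors v ↔ t ∈ l) → ∀ t, G.Adj x t → t ∈ v :: l := by
    intro x hx hv l hl t ht
    by_cases htv : t = v
    · rw [htv]
      exact List.mem_cons_self
    refine List.mem_cons_of_mem _ ((hl t).1 (mem_highNeighbors.2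
      ⟨((subsumes_iff _ _ _).1 hv).2 t ht htv, fun h => ?_⟩))
    exact not_adj_of_degree_le_six hrob hred (mem_lowNeighbors.1 ((hmem x).2 hx)).2 h ht
  have two : ∀ {x y z s t : V}, [x, y, z, d].Perm [a, b, c, d] → G.Subsumes v x →
      G.Subsumes v y → G.Subsumes v z → s ∈ G.highNeighbors v → t ∈ G.highNeighbors v → s ≠ t →
      (∀ c ∈ G.highNeighbors v, c ≠ s → G.Adj x c) →
      (∀ c ∈ G.highNeighbors v, c ≠ s → G.Adj y c) →
      (∀ c ∈ G.highNeighbors v, c ≠ t → G.Adj z c) → False := by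
    intro x y z s t hperm hx hy hz hs ht hst hxs hys hzt
    obtain ⟨l, hl, hlC, hlen⟩ := exists_list_of_subset (C := G.highNeighbors v) (pre := [s, t])
      (by simp [hst]) (by simp [hs, ht])
    match l, hl, hlC, hlen with
    | [e, f, g], hl, hlC, _ =>
      obtain ⟨hnd, hN⟩ := setup hperm hl hlC
      have mx : x ∈ [a, b, c, d] := hperm.mem_iff.1 (by simp)
      have my : y ∈ [a, b, c, d] := hperm.mem_iff.1 (by simp)
      have mz : z ∈ [a, b, c, d] := hperm.mem_iff.1 (by simp)
      have hl' := hl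
      simp only [List.cons_append, List.nil_append, List.nodup_cons, List.mem_cons,
        List.not_mem_nil, or_false, not_or] at hl'
      have l1 : ∀ w ∈ [t, e, f, g], w ∈ G.highNeighbors v ∧ w ≠ s := fun w hw =>
        ⟨(hlC w).2 (List.mem_cons_of_mem _ hw), fun h =>
          (List.nodup_cons.1 hl).1 (h ▸ hw)⟩
      have l2 : ∀ w ∈ [s, e, f, g], w ∈ G.highNeighbors v ∧ w ≠ t := by
        simp only [List.mem_cons, List.not_mem_nil, or_false, forall_eq_or_imp, forall_eq]
        exact ⟨⟨hs, hst⟩, ⟨(hlC e).2 (by simp), Ne.symm hl'.2.1.1⟩,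
          ⟨(hlC f).2 (by simp), Ne.symm hl'.2.1.2.1⟩, ⟨(hlC g).2 (by simp), Ne.symm hl'.2.1.2.2⟩⟩
      exact nineTwo.contradiction hrob hred v hnd rfl
        ⟨fun w hw => (hN w).1 hw, fun w hw => hub mx hx hlC w hw, fun w hw => hub my hy hlC w hw,
          fun w hw => hub mz hz hlC w hw⟩
        ⟨fun w hw => (hN w).2 hw, fun w hw => hxs w (l1 w hw).1 (l1 w hw).2,
          fun w hw => hys w (l1 w hw).1 (l1 w hw).2, fun w hw => hzt w (l2 w hw).1 (l2 w hw).2⟩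
        trivial trivial ⟨hone mx hx hxs _ l1, hone mz hz hzt _ l2⟩ nineTwo_check
    | [], _, _, hlen | [_], _, _, hlen | [_, _], _, _, hlen | _ :: _ :: _ :: _ :: _, _, _, hlen =>
      simp [hC] at hlen; try omega
  -- The exceptional high neighbours of the three subsumed vertices may all coincide, coincide in
  -- two, or be distinct, up to renaming.
  by_cases hpq : p = q
  · subst hpq
    by_cases hpr : p = r
    · subst hpr
      obtain ⟨l, hl, hlC, hlen⟩ := exists_list_of_subset (C := G.highNeighbors v) (pre := [p])
        (by simp) (by simp [hp])
      match l, hl, hlC, hlen with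
      | [e, f, g, h], hl, hlC, _ =>
        obtain ⟨hnd, hN⟩ := setup (List.Perm.refl _) hl hlC
        have l1 : ∀ w ∈ [e, f, g, h], w ∈ G.highNeighbors v ∧ w ≠ p := fun w hw =>
          ⟨(hlC w).2 (List.mem_cons_of_mem _ hw), fun h =>
            (List.nodup_cons.1 hl).1 (h ▸ hw)⟩
        exact nineSame.contradiction hrob hred v hnd rfl
          ⟨fun w hw => (hN w).1 hw, fun w hw => hub (by simp) ha hlC w hw,
            fun w hw => hub (by simp) hb hlC w hw, fun w hw => hub (by simp) hc hlC w hw⟩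
          ⟨fun w hw => (hN w).2 hw, fun w hw => hap w (l1 w hw).1 (l1 w hw).2,
            fun w hw => hbq w (l1 w hw).1 (l1 w hw).2, fun w hw => hcr w (l1 w hw).1 (l1 w hw).2⟩
          trivial trivial (hone (by simp) ha hap _ l1) nineSame_check
      | [], _, _, hlen | [_], _, _, hlen | [_, _], _, _, hlen | [_, _, _], _, _, hlen
      | _ :: _ :: _ :: _ :: _ :: _, _, _, hlen => simp [hC] at hlen; try omega
    · exact two (List.Perm.refl _) ha hb hc hp hr hpr hap hbq hcr
  by_cases hpr : p = r
  · subst hpr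
    exact two ((List.Perm.swap b c [d]).cons a) ha hc hb hp hq hpq hap hcr hbq
  by_cases hqr : q = r
  · subst hqr
    refine two (List.Perm.trans ((List.Perm.swap a c [d]).cons b) (List.Perm.swap a b [c, d]))
      hb hc ha hq hp (Ne.symm hpq) hbq hcr hap
  obtain ⟨l, hl, hlC, hlen⟩ := exists_list_of_subset (C := G.highNeighbors v) (pre := [p, q, r])
    (by simp [hpq, hpr, hqr]) (by simp [hp, hq, hr])
  match l, hl, hlC, hlen with
  | [g, h], hl, hlC, _ =>
    obtain ⟨hnd, hN⟩ := setup (List.Perm.refl _) hl hlC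
    have hg := (hlC g).2 (by simp)
    have hh := (hlC h).2 (by simp)
    simp only [List.cons_append, List.nil_append, List.nodup_cons, List.mem_cons,
      List.not_mem_nil, or_false, not_or] at hl
    obtain ⟨⟨-, -, hpg, hph⟩, ⟨-, hqg, hqh⟩, ⟨hrg, hrh⟩, -⟩ := hl
    have l1 : ∀ w ∈ [q, r, g, h], w ∈ G.highNeighbors v ∧ w ≠ p := by
      simp [hq, hr, hg, hh, Ne.symm hpq, Ne.symm hpr, Ne.symm hpg, Ne.symm hph]
    have l2 : ∀ w ∈ [p, r, g, h], w ∈ G.highNeighbors v ∧ w ≠ q := by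
      simp [hp, hr, hg, hh, hpq, Ne.symm hqr, Ne.symm hqg, Ne.symm hqh]
    have l3 : ∀ w ∈ [p, q, g, h], w ∈ G.highNeighbors v ∧ w ≠ r := by
      simp [hp, hq, hg, hh, hpr, hqr, Ne.symm hrg, Ne.symm hrh]
    exact nineDistinct.contradiction hrob hred v hnd rfl
      ⟨fun w hw => (hN w).1 hw, fun w hw => hub (by simp) ha hlC w hw,
        fun w hw => hub (by simp) hb hlC w hw, fun w hw => hub (by simp) hc hlC w hw⟩
      ⟨fun w hw => (hN w).2 hw, fun w hw => hap w (l1 w hw).1 (l1 w hw).2,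
        fun w hw => hbq w (l2 w hw).1 (l2 w hw).2, fun w hw => hcr w (l3 w hw).1 (l3 w hw).2⟩
      trivial trivial ⟨hone (by simp) ha hap _ l1, hone (by simp) hb hbq _ l2,
        hone (by simp) hc hcr _ l3⟩ nineDistinct_check
  | [], _, _, hlen | [_], _, _, hlen | _ :: _ :: _ :: _, _, _, hlen => simp [hC] at hlen; try omega

/-- A vertex of degree nine with at least four `6⁻`-neighbours subsumes at most two of them. -/
theorem card_le_two_of_subsumes (hrob : G.IsRobust)
    (hred : ¬ ∃ V₀ : Set V, G.IsReducible V₀) {v : V} (hv : G.degree v = 9)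
    (hB : 4 ≤ (G.lowNeighbors v).card) {S : Finset V} (hS : S ⊆ G.lowNeighbors v)
    (hsub : ∀ w ∈ S, G.Subsumes v w) : S.card ≤ 2 := by
  by_contra! h3
  obtain ⟨T, hTS, hT⟩ := Finset.exists_subset_card_eq h3
  obtain ⟨a, b, c, hab, hac, hbc, rfl⟩ := Finset.card_eq_three.1 hT
  have hTB := hTS.trans hS
  have hsum := card_lowNeighbors_add_card_highNeighbors (G := G) v
  have ha := hsub a (hTS (by simp))
  rcases Nat.lt_or_ge 4 (G.lowNeighbors v).card with h5 | h4
  · exact not_subsumes_of_card_highNeighbors_le_five hrob hred (hTB (by simp)) h5 (by omega) ha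
  obtain ⟨l, hnd, hmem, hlen⟩ := exists_list_of_subset (C := G.lowNeighbors v) (pre := [a, b, c])
    (by simp [hab, hac, hbc]) (fun x hx => hTB (by simpa using hx))
  match l, hnd, hmem, hlen with
  | [d], hnd, hmem, _ =>
    exact not_subsumes_three hrob hred (by ext x; simp [hmem]) (by omega) hnd ha
      (hsub b (hTS (by simp))) (hsub c (hTS (by simp)))
  | [], _, _, hlen | _ :: _ :: _, _, _, hlen => simp at hlen; omega

end
end SimpleGraph

/-! ### The main theorem -/

theorem mainTheorem3 {V : Type*} [Fintype V] [DecidableEq V] (G : SimpleGraph V)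
    [DecidableRel G.Adj] (hrobust : G.IsRobust)
    (hred : ¬ ∃ V₀ : Set V, G.IsReducible V₀) :
    -- (a)
    (∀ v : V, G.degree v ≤ 6 →
      ((G.nbhdGraph v)ᶜ).maxDegree ≤ 1 ∧ ((G.nbhdGraph v)ᶜ).edgeFinset.card ≠ 2) ∧
    -- (b)
    G.IsIndepSet {v : V | G.degree v ≤ 6} ∧
    -- (c)
    (∀ u v : V, G.degree u = 7 → G.degree v = 6 → ¬ G.Subsumes u v) ∧
    -- (d)
    (∀ u v : V, G.degree u = 7 → G.IsThin v → ¬ G.Adj u v) ∧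
    -- (e)
    (∀ u v : V, G.degree u ≤ 8 → G.degree v = 5 → ¬ G.Subsumes u v) ∧
    -- (f)
    (∀ v : V, G.degree v = 9 →
      {w : V | G.degree w ≤ 6 ∧ G.Subsumes v w}.ncard ≤ 3 ∧
      ({w : V | G.degree w ≤ 6 ∧ G.Subsumes v w}.ncard = 3 →
        {w : V | G.degree w ≤ 6 ∧ G.Adj v w}.ncard = 3)) ∧
    -- (g)
    (∀ v : V, 10 ≤ G.degree v → (∃ w : V, G.degree w ≤ 6 ∧ G.Subsumes v w) →
      {w : V | G.degree w ≤ 6 ∧ G.Adj v w}.ncard ≤ G.degree v - 6) ∧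
    -- (h)
    (∀ v : V, 7 ≤ G.degree v → G.degree v ≤ 9 →
      {w : V | G.degree w ≤ 6 ∧ G.Adj v w}.ncard ≤ G.degree v - 4) := by
  have hncard : ∀ v, {w : V | G.degree w ≤ 6 ∧ G.Adj v w}.ncard = (G.lowNeighbors v).card := by
    intro v
    rw [← Set.ncard_coe_finset]
    congr 1
    ext w
    simp [SimpleGraph.mem_lowNeighbors, and_comm]
  refine ⟨fun v hv => ⟨SimpleGraph.complement_maxDegree_le_one hrobust hred hv,
    SimpleGraph.complement_card_edgeFinset_ne_two hrobust hred hv⟩,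
    fun u hu v hv _ => SimpleGraph.not_adj_of_degree_le_six hrobust hred hu hv,
    fun u v => SimpleGraph.not_subsumes_of_degree_eq_seven hrobust hred,
    fun u v => SimpleGraph.not_adj_of_isThin hrobust hred,
    fun u v => SimpleGraph.not_subsumes_of_degree_le_eight hrobust hred, ?_, ?_, ?_⟩
  · intro v hv
    obtain ⟨S, hS⟩ := (Set.toFinite {w : V | G.degree w ≤ 6 ∧ G.Subsumes v w}).exists_finset_coe
    have hmem : ∀ w, w ∈ S ↔ G.degree w ≤ 6 ∧ G.Subsumes v w := fun w => by
      rw [← Finset.mem_coe, hS, Set.mem_ofPred_eq]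
    have hsub : S ⊆ G.lowNeighbors v := fun w hw => SimpleGraph.mem_lowNeighbors.2
      ⟨((SimpleGraph.subsumes_iff _ _ _).1 ((hmem w).1 hw).2).1.symm, ((hmem w).1 hw).1⟩
    rw [← hS, Set.ncard_coe_finset, hncard]
    have hle := Finset.card_le_card hsub
    -- With at least four low neighbours at most two are subsumed; so three subsumed ones are all
    -- the low neighbours.
    have h2 := fun h => SimpleGraph.card_le_two_of_subsumes hrobust hred hv h hsub
      fun w hw => ((hmem w).1 hw).2
    omega
  · rintro v hv ⟨w, hw, hvw⟩
    rw [hncard]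
    by_contra! hcon
    have hsum := SimpleGraph.card_lowNeighbors_add_card_highNeighbors (G := G) v
    -- More than d(v) - 6 low neighbours means at least five, as d(v) is at least ten, and leaves at
    -- most five high ones.
    exact SimpleGraph.not_subsumes_of_card_highNeighbors_le_five hrobust hred
      (SimpleGraph.mem_lowNeighbors.2 ⟨((SimpleGraph.subsumes_iff _ _ _).1 hvw).1.symm, hw⟩)
      (by omega) (by omega) hvw
  · intro v hv _
    rw [hncard]
    exact SimpleGraph.card_lowNeighbors_le hrobust hred hv
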